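/- Let $p$ be a power of $2$ with $p\ge 2$, let $q_1=p^k$ with $k\ge1$, let $n\ge 1$ and $q=q_1^{2n}$. Let $\mathbb F$ be an algebraic closure of $\mathbb F_q$, and for $i\ge0$ let $x\mapsto x^{p^{-i}}$ denote the inverse of $x\mapsto x^{p^i}$ on $\mathbb F$. Let $e\ge1$ and $F(x)=\sum_{i=0}^e b_i x^{p^i}$ with $b_i\in\mathbb F_q$, and set $$F^*(x)=\sum_{i=0}^e (b_ix)^{p^{-i}},\qquad E_F=F^*\circ F,\qquad W_F^*=\{x\in\mathbb F: F^*(x)=0\},\qquad V_F=\{x\in\mathbb F: E_F(x)=0\}.$$ Assume: (i) $b_0b_e\ne0$; (ii) $F^*(1)=0$; (iii) $W_F^*\subset\mathbb F_q$; (iv) $V_F\subset\mathbb F_q$; and moreover $W_F^*\subset\mathbb F_{q_1}$. Define $$R(x)=R_F(x)=\sum_{i=1}^e a_ix^{p^i},\quad a_i=\sum_{j=0}^{e-i}(b_jb_{j+i})^{p^{-j}},\qquad \alpha_F(t)=\sum_{0\le i<j\le e}b_i^{p^{-i}}b_j^{p^{-j}}+F^*(t)^2,\qquad R_{F,t}(x)=R_F(x)+\alpha_F(t)x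 .$$ For $a\in\mathbb F_q$ let $C_a$ be the affine curve $y^p-y=x(R(x)+ax)$ over $\mathbb F_q$, and set $$T_{R,\max}=\{a\in\mathbb F_q: |C_a(\mathbb F_q)|=q+(p-1)p^e\sqrt q\},\qquad T_{R,\min}=\{a\in\mathbb F_q: |C_a(\mathbb F_q)|=q-(p-1)p^e\sqrt q\}.$$ Let $\ell$ be an odd prime, $\sqrt{-1}\in\overline{\mathbb Q}_\ell$ a primitive fourth root of unity, $W_2$ the ring of $2$-typical Witt vectors of length two, $\xi_2\colon W_2(\mathbb F_2)\to\overline{\mathbb Q}_\ell^\times$ the character with $\xi_2(1,0)=\sqrt{-1}$, and $\mathrm{Tr}_{q/2}\colon W_2(\mathbb F_q)\to W_2(\mathbb F_2)$, $(x,y)\mapsto\sum_{i=0}^{[\mathbb F_q:\mathbb F_2]-1}(x^{2^i},y^{2^i})$ the trace. Put $Q_q(x)=\xi_2(\mathrm{Tr}_{q/2}(x,0))$, $\psi_q(x)=\xi_2(\mathrm{Tr}_{q/2}(0,x))$ for $x\in\mathbb F_q$, and $$S_F=\{t\in\mathbb F_q: Q_q(v)=\psi_q(tv)\ \text{for all}\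 v\in W_F^*\},\qquad S_{F,-}=\{t\in S_F: Q_q(t)=-(\sqrt{-1})^{[\mathbb F_q:\mathbb F_2]/2}\}.$$ Then the following hold. 1. There exists $t_0\in\mathbb F_{q_1^2}$ with $t_0^{q_1}+t_0=1$. 2. For every $t_0$ as in 1, $S_F=t_0+F(\mathbb F_q)$ and $T_{R,\max}\cup T_{R,\min}=\alpha_F(t_0)+E_F(\mathbb F_q)^2$, where $E_F(\mathbb F_q)^2=\{E_F(u)^2:u\in\mathbb F_q\}$. 3. For every $t_0$ as in 1, with $\mathrm{Tr}_{q/2}\colon\mathbb F_q\to\mathbb F_2$ the field trace and $n+1$ read in $\mathbb F_2$, $$S_{F,-}=\{t_0+F(u): u\in\mathbb F_q,\ \mathrm{Tr}_{q/2}(uR_{F,t_0}(u))=n+1\},$$ $$T_{R,\max}=\{\alpha_F(t_0)+E_F(u)^2: u\in\mathbb F_q,\ \mathrm{Tr}_{q/2}(uR_{F,t_0}(u))=n+1\}.$$ -/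

import Mathlib

noncomputable section

namespace GeerVlugt

/-! Throughout `p = 2 ^ m`.  An additive polynomial `F(x) = ∑_{i=0}^e b_i x^{p^i}` is given by its
degree index `e` and its coefficient sequence `b` (only `b 0, …, b e` are ever used). -/

section Additive

variable {L : Type*} [Field L] [CharP L 2] [PerfectRing L 2]

/-- `x ^ (p ^ (-i))` for `p = 2 ^ m`: the unique `y` with `y ^ (p ^ i) = x`. -/
def root (m i : ℕ) (x : L) : L := (iterateFrobeniusEquiv L 2 (m * i)).symm x

theorem root_pow (m i : ℕ) (x : L) : root m i x ^ (2 ^ m) ^ i = x := by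
  have h := (iterateFrobeniusEquiv L 2 (m * i)).apply_symm_apply x
  rw [iterateFrobeniusEquiv_def, pow_mul] at h
  exact h

/-- `F(x) = ∑_{i=0}^e b_i x^{p^i}`. -/
def linF (m e : ℕ) (b : ℕ → L) (x : L) : L :=
  ∑ i ∈ Finset.range (e + 1), b i * x ^ (2 ^ m) ^ i

/-- The adjoint `F^*(x) = ∑_{i=0}^e (b_i x)^{p^{-i}}`. -/
def adjF (m e : ℕ) (b : ℕ → L) (x : L) : L :=
  ∑ i ∈ Finset.range (e + 1), root m i (b i * x)

/-- `E_F = F^* ∘ F`. -/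
def EF (m e : ℕ) (b : ℕ → L) (x : L) : L := adjF m e b (linF m e b x)

/-- The coefficients `a_i = ∑_{j=0}^{e-i} (b_j b_{j+i})^{p^{-j}}` (for `1 ≤ i ≤ e`) of `R_F`. -/
def coeffRF (m e : ℕ) (b : ℕ → L) (i : ℕ) : L :=
  ∑ j ∈ Finset.range (e - i + 1), root m j (b j * b (j + i))

/-- `R(x) = ∑_{i=1}^e a_i x^{p^i}`. -/
def evalR (m e : ℕ) (a : ℕ → L) (x : L) : L :=
  ∑ i ∈ Finset.Icc 1 e, a i * x ^ (2 ^ m) ^ i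

/-- `γ_F = ∑_{0 ≤ i < j ≤ e} b_i^{p^{-i}} b_j^{p^{-j}}`. -/
def gammaF (m e : ℕ) (b : ℕ → L) : L :=
  ∑ j ∈ Finset.range (e + 1), ∑ i ∈ Finset.range j, root m i (b i) * root m j (b j)

/-- `α_F(t) = γ_F + F^*(t)^2`. -/
def alphaF (m e : ℕ) (b : ℕ → L) (t : L) : L := gammaF m e b + adjF m e b t ^ 2

/-- `R_{F,t}(x) = R_F(x) + α_F(t) x`. -/
def RFt (m e : ℕ) (b : ℕ → L) (t x : L) : L :=
  evalR m e (coeffRF m e b) x + alphaF m e b t * x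

end Additive

section Kernels

variable {K : Type*} [Field K] [Finite K] [CharP K 2]

/-- `W_F^*`, the kernel of `F^*` on an algebraic closure of `𝔽_q = K`. -/
def WFstar (m e : ℕ) (b : ℕ → K) : Set (AlgebraicClosure K) :=
  {x | adjF m e (fun i => algebraMap K (AlgebraicClosure K) (b i)) x = 0}

/-- `V_F`, the kernel of `F^* F` on an algebraic closure of `𝔽_q = K`. -/
def VF (m e : ℕ) (b : ℕ → K) : Set (AlgebraicClosure K) :=
  {x | EF m e (fun i => algebraMap K (AlgebraicClosure K) (b i)) x = 0}

/-- Conditions (i)–(iv) on `F = ∑_{i=0}^e b_i x^{p^i}` over `𝔽_q = K`. -/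
structure Admissible (m e : ℕ) (b : ℕ → K) : Prop where
  one_le : 1 ≤ e
  coeff_ne_zero : b 0 * b e ≠ 0
  adj_one : adjF m e b 1 = 0
  WFstar_subset : WFstar m e b ⊆ Set.range (algebraMap K (AlgebraicClosure K))
  VF_subset : VF m e b ⊆ Set.range (algebraMap K (AlgebraicClosure K))

end Kernels

section Curves

variable {K : Type*} [Field K]

/-- The `𝔽_q`-points of the affine curve `C_a : y^p - y = x (R(x) + a x)`, where
`R(x) = ∑_{i=1}^e c_i x^{p^i}`. -/
def curvePoints (m e : ℕ) (c : ℕ → K) (a : K) : Set (K × K) :=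
  {P | P.2 ^ 2 ^ m - P.2 = P.1 * (evalR m e c P.1 + a * P.1)}

/-- `T_{R,max}`: those `a ∈ 𝔽_q` with `|C_a(𝔽_q)| = q + (p - 1) p^e √q`. -/
def Tmax (m e : ℕ) (c : ℕ → K) : Set K :=
  {a | ((curvePoints m e c a).ncard : ℝ) =
    (Nat.card K : ℝ) + ((2 : ℝ) ^ m - 1) * ((2 : ℝ) ^ m) ^ e * √(Nat.card K : ℝ)}

/-- `T_{R,min}`: those `a ∈ 𝔽_q` with `|C_a(𝔽_q)| = q - (p - 1) p^e √q`. -/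
def Tmin (m e : ℕ) (c : ℕ → K) : Set K :=
  {a | ((curvePoints m e c a).ncard : ℝ) =
    (Nat.card K : ℝ) - ((2 : ℝ) ^ m - 1) * ((2 : ℝ) ^ m) ^ e * √(Nat.card K : ℝ)}

end Curves

section Witt

/-- The Witt vector `(x, y)` of length two. -/
def witt {R : Type*} (x y : R) : TruncatedWittVector 2 2 R := TruncatedWittVector.mk 2 ![x, y]

/-- The character `ξ_2` of `W_2(𝔽_2) = ℤ/4ℤ` with `ξ_2(1, 0) = I`. -/
def xi2 {Ω : Type*} [Field Ω] {I : Ω} (hI : IsPrimitiveRoot I 4) :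
    AddChar (TruncatedWittVector 2 2 (ZMod 2)) Ω :=
  (AddChar.zmodChar (2 ^ 2) (ζ := I) hI.pow_eq_one).compAddMonoidHom
    (TruncatedWittVector.zmodEquivTrunc 2 2).symm.toRingHom.toAddMonoidHom

theorem xi2_one {Ω : Type*} [Field Ω] {I : Ω} (hI : IsPrimitiveRoot I 4) :
    xi2 hI (witt 1 0) = I := by
  have h1 : (witt 1 0 : TruncatedWittVector 2 2 (ZMod 2)) = 1 := by
    ext i
    have h : (1 : TruncatedWittVector 2 2 (ZMod 2)).coeff i = (1 : WittVector 2 (ZMod 2)).coeff i := by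
      rw [← map_one (WittVector.truncate (p := 2) (R := ZMod 2) 2), WittVector.coeff_truncate]
    rw [h]
    fin_cases i
    · simp [witt, TruncatedWittVector.coeff_mk]
    · simp [witt, TruncatedWittVector.coeff_mk, WittVector.one_coeff_eq_of_pos]
  have h2 : xi2 hI (witt 1 0) = AddChar.zmodChar (2 ^ 2) (ζ := I) hI.pow_eq_one
      ((TruncatedWittVector.zmodEquivTrunc 2 2).symm (witt 1 0)) := rfl
  rw [h2, h1, map_one]
  have h3 := AddChar.zmodChar_apply' (n := 2 ^ 2) (ζ := I) hI.pow_eq_one 1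
  simpa using h3

variable {K : Type*} [Field K] [Finite K] [CharP K 2] [Algebra (ZMod 2) K]

/-- `∑_{i=0}^{N-1} (x^{2^i}, y^{2^i})` in `W_2(𝔽_q)`, where `q = 2^N` and `w = (x, y)`. -/
def frobeniusSum (w : TruncatedWittVector 2 2 K) : TruncatedWittVector 2 2 K :=
  ∑ i ∈ Finset.range (Module.finrank (ZMod 2) K),
    witt (w.coeff 0 ^ 2 ^ i) (w.coeff 1 ^ 2 ^ i)

/-- The sum defining the trace of `W_2(𝔽_q)` lies in `W_2(𝔽_2)`. -/
theorem exists_wittTrace (w : TruncatedWittVector 2 2 K) :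
    ∃ z : TruncatedWittVector 2 2 (ZMod 2),
      witt (algebraMap (ZMod 2) K (z.coeff 0)) (algebraMap (ZMod 2) K (z.coeff 1)) =
        frobeniusSum w := by
  have : Fintype K := Fintype.ofFinite K
  set N := Module.finrank (ZMod 2) K with hN
  have hcard : ∀ c : K, c ^ 2 ^ N = c := by
    intro c
    have h := Module.card_eq_pow_finrank (K := ZMod 2) (V := K)
    rw [ZMod.card] at h
    rw [hN, ← h]
    exact FiniteField.pow_card c
  set S : WittVector 2 K :=
    ∑ i ∈ Finset.range N, WittVector.map (iterateFrobenius K 2 i) w.out with hS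
  have hcoeff : ∀ i (j : Fin 2), (WittVector.map (iterateFrobenius K 2 i) w.out).coeff j =
      w.coeff j ^ 2 ^ i := by
    intro i j
    rw [WittVector.map_coeff, TruncatedWittVector.coeff_out, iterateFrobenius_def]
  have hsum : frobeniusSum w = WittVector.truncate 2 S := by
    rw [hS, map_sum, frobeniusSum]
    refine Finset.sum_congr rfl fun i _ => ?_
    ext j
    rw [WittVector.coeff_truncate, hcoeff]
    fin_cases j <;> simp [witt, TruncatedWittVector.coeff_mk]
  have hfix : WittVector.map (frobenius K 2) S = S := by
    have hstep : ∀ i, WittVector.map (frobenius K 2)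
        (WittVector.map (iterateFrobenius K 2 i) w.out) =
        WittVector.map (iterateFrobenius K 2 (i + 1)) w.out := by
      intro i
      ext j
      simp only [WittVector.map_coeff, iterateFrobenius_def, frobenius_def]
      rw [← pow_mul, ← pow_succ]
    have hends : WittVector.map (iterateFrobenius K 2 N) w.out =
        WittVector.map (iterateFrobenius K 2 0) w.out := by
      ext j
      simp only [WittVector.map_coeff, iterateFrobenius_def]
      rw [hcard, pow_zero, pow_one]
    rw [hS, map_sum, Finset.sum_congr rfl fun i _ => hstep i]
    have h1 := Finset.sum_range_succ (fun i => WittVector.map (iterateFrobenius K 2 i) w.out) N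
    have h2 := Finset.sum_range_succ' (fun i => WittVector.map (iterateFrobenius K 2 i) w.out) N
    rw [h1, hends] at h2
    exact (add_right_cancel h2).symm
  have hmem : ∀ j, ∃ c : ZMod 2, algebraMap (ZMod 2) K c = S.coeff j := by
    intro j
    have h : S.coeff j ^ 2 = S.coeff j := by
      conv_rhs => rw [← hfix]
      rw [WittVector.map_coeff, frobenius_def]
    rcases eq_or_ne (S.coeff j) 0 with h0 | h0
    · exact ⟨0, by rw [map_zero, h0]⟩
    · refine ⟨1, ?_⟩
      rw [map_one]
      rw [pow_two] at h
      exact (mul_left_cancel₀ h0 (h.trans (mul_one _).symm)).symm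
  obtain ⟨c0, h0⟩ := hmem 0
  obtain ⟨c1, h1⟩ := hmem 1
  refine ⟨witt c0 c1, ?_⟩
  rw [hsum]
  ext j
  rw [WittVector.coeff_truncate]
  fin_cases j
  · simpa [witt, TruncatedWittVector.coeff_mk] using h0
  · simpa [witt, TruncatedWittVector.coeff_mk] using h1

/-- The trace map `Tr_{q/2} : W_2(𝔽_q) → W_2(𝔽_2)`: the element of `W_2(𝔽_2)` whose image in
`W_2(𝔽_q)` is `∑_{i=0}^{N-1} (x^{2^i}, y^{2^i})`. -/
def wittTrace (w : TruncatedWittVector 2 2 K) : TruncatedWittVector 2 2 (ZMod 2) :=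
  (exists_wittTrace w).choose

theorem wittTrace_spec (w : TruncatedWittVector 2 2 K) :
    witt (algebraMap (ZMod 2) K ((wittTrace w).coeff 0))
      (algebraMap (ZMod 2) K ((wittTrace w).coeff 1)) = frobeniusSum w :=
  (exists_wittTrace w).choose_spec

variable {Ω : Type*} [Field Ω] {I : Ω}

/-- `Q_q(x) = ξ_2(Tr_{q/2}(x, 0))`. -/
def Qq (hI : IsPrimitiveRoot I 4) (x : K) : Ω := xi2 hI (wittTrace (witt x 0))

/-- `ψ_q(x) = ξ_2(Tr_{q/2}(0, x))`. -/
def psiq (hI : IsPrimitiveRoot I 4) (x : K) : Ω := xi2 hI (wittTrace (witt 0 x))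

/-- `S_F = {t ∈ 𝔽_q | Q_q(v) = ψ_q(t v) for all v ∈ W_F^*}`. -/
def SF (hI : IsPrimitiveRoot I 4) (m e : ℕ) (b : ℕ → K) : Set K :=
  {t | ∀ v : K, algebraMap K (AlgebraicClosure K) v ∈ WFstar m e b →
    Qq hI v = psiq hI (t * v)}

/-- `S_{F,-} = {t ∈ S_F | Q_q(t) = -(√-1)^{[𝔽_q : 𝔽_2]/2}}`. -/
def SFminus (hI : IsPrimitiveRoot I 4) (m e : ℕ) (b : ℕ → K) : Set K :=
  {t ∈ SF hI m e b | Qq hI t = -I ^ (Module.finrank (ZMod 2) K / 2)}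

end Witt

end GeerVlugt

end

noncomputable section

namespace GeerVlugt

/-! The carry in Witt addition makes $Q=Q_q$ quadratic: $Q(x+y)=Q(x)Q(y)\psi(xy)$ (`Qq_add`), with
$\psi=(-1)^{\mathrm{Tr}}$. Since $F^*(1)=0$, pulling $Q$ back along $F$ leaves only signs,
$Q(F(x))=\psi(x(R_F(x)+\gamma_F x))$ (`Qq_linF`). Hence $Q(t+F(u))=Q(t)\psi(uR_{F,t}(u))$
(`Qq_add_linF`).

Counting points gives $|C_a|=q+(p-1)\Sigma(a)$ with $\Sigma(a)=\sum_x\psi(x(R(x)+ax))$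
(`ncard_curvePoints`). For $t\in S_F$, trace duality between $F$ and $F^*$ turns the sum of $Q$ over
the coset $t+F(\mathbb F_q)$ into the full Gauss sum, so $\Sigma(\alpha_F(t))Q(t)=p^e\sum_sQ(s)$
(`formSum_alphaF_mul_Qq`). The Gauss sum is $-\sqrt q\,I^{N/2}$, where $N=[\mathbb F_q:\mathbb F_2]$
(`sum_Qq`).

If $t_0^{q_1}+t_0=1$, direct trace computations give $Q(v)=\psi(t_0v)$ on $\mathbb F_{q_1}\supset
W_F^*$, so $t_0\in S_F$, and $Q(t_0)=(-1)^nI^{N/2}$. Thus $\Sigma(\alpha_F(t_0)+E_F(u)^2)=\pm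
p^e\sqrt q$ with an explicit sign (`formSum_alphaF_add_EF_sq`).

Conversely, $\Sigma(a)\ne0$ forces the form to be trivial on the rational points of $V_F$; two such
$a$ differ by the square of an element orthogonal to $\ker E_F$, hence of a value of the
self-adjoint map $E_F$ (`exists_eq_add_EF_sq`). -/

/-! ### Witt vectors of length two and their Frobenius sums. -/

theorem wittAdd_two_one :
    WittVector.wittAdd 2 1 = MvPolynomial.X (0, 1) + MvPolynomial.X (1, 1)
      - MvPolynomial.X (0, 0) * MvPolynomial.X (1, 0) := by
  have h := wittStructureInt_prop 2 (MvPolynomial.X 0 + MvPolynomial.X 1 : MvPolynomial (Fin 2) ℤ) 1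
  have h0 := WittVector.wittAdd_zero 2
  rw [WittVector.wittAdd] at h0 ⊢
  rw [wittPolynomial_one] at h
  simp only [map_add, map_mul, map_pow, MvPolynomial.bind₁_X_right, MvPolynomial.rename_X, h0,
    MvPolynomial.bind₁_C_right, MvPolynomial.rename_C] at h
  have h2 : (MvPolynomial.C ((2 : ℕ) : ℤ) : MvPolynomial (Fin 2 × ℕ) ℤ) ≠ 0 := by
    simp
  -- `h` compares second ghost components, $S_0^2+2S_1$; over $\mathbb Z$ the factor 2 can be
  -- cancelled.
  apply mul_left_cancel₀ h2
  have hC : (MvPolynomial.C ((2 : ℕ) : ℤ) : MvPolynomial (Fin 2 × ℕ) ℤ) = 2 := by simp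
  rw [hC] at h ⊢
  linear_combination h

theorem witt_coeff {R : Type*} (x y : R) : (witt x y).coeff 0 = x ∧ (witt x y).coeff 1 = y := by
  simp [witt, TruncatedWittVector.coeff_mk]

theorem witt_add {R : Type*} [CommRing R] (x y x' y' : R) :
    witt x y + witt x' y' = witt (x + x') (y + y' - x * x') := by
  have h : witt x y + witt x' y' = WittVector.truncate 2 ((witt x y).out + (witt x' y').out) := by
    rw [map_add]
    exact congrArg₂ _ (TruncatedWittVector.truncateFun_out _).symm
      (TruncatedWittVector.truncateFun_out _).symm
  have hc₀ : ∀ a b : R, (witt a b).out.coeff 0 = a := fun a b =>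
    (TruncatedWittVector.coeff_out (witt a b) 0).trans (witt_coeff a b).1
  have hc₁ : ∀ a b : R, (witt a b).out.coeff 1 = b := fun a b =>
    (TruncatedWittVector.coeff_out (witt a b) 1).trans (witt_coeff a b).2
  rw [h]
  ext i
  rw [WittVector.coeff_truncate]
  fin_cases i
  · refine Eq.trans ?_ (witt_coeff _ _).1.symm
    simp [WittVector.add_coeff_zero, hc₀]
  · refine Eq.trans ?_ (witt_coeff _ _).2.symm
    simp [WittVector.add_coeff, wittAdd_two_one, WittVector.peval, hc₀, hc₁]

theorem witt_eta {R : Type*} (w : TruncatedWittVector 2 2 R) : witt (w.coeff 0) (w.coeff 1) = w := by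
  ext i
  fin_cases i <;> simp [witt, TruncatedWittVector.coeff_mk]

theorem witt_inj {R : Type*} {x y x' y' : R} : witt x y = witt x' y' ↔ x = x' ∧ y = y' := by
  refine ⟨fun h => ⟨?_, ?_⟩, fun h => by rw [h.1, h.2]⟩
  · rw [← (witt_coeff x y).1, h, (witt_coeff x' y').1]
  · rw [← (witt_coeff x y).2, h, (witt_coeff x' y').2]

theorem witt_zero {R : Type*} [CommRing R] : (witt 0 0 : TruncatedWittVector 2 2 R) = 0 := by
  ext i
  fin_cases i <;> simp [witt, TruncatedWittVector.coeff_mk, TruncatedWittVector.coeff_zero]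

/-- The coefficientwise power map `(x, y) ↦ (x^{2^i}, y^{2^i})` on Witt vectors of length two. -/
def wittFrob (L : Type*) [CommRing L] [CharP L 2] (i : ℕ) :
    TruncatedWittVector 2 2 L →+ TruncatedWittVector 2 2 L where
  toFun w := witt (w.coeff 0 ^ 2 ^ i) (w.coeff 1 ^ 2 ^ i)
  map_zero' := by
    simp [TruncatedWittVector.coeff_zero, witt_zero]
  map_add' v w := by
    rw [← witt_eta v, ← witt_eta w, witt_add]
    simp only [witt_coeff, witt_add]
    rw [add_pow_char_pow, sub_pow_char_pow, add_pow_char_pow, mul_pow]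

theorem wittFrob_apply {L : Type*} [CommRing L] [CharP L 2] (i : ℕ) (x y : L) :
    wittFrob L i (witt x y) = witt (x ^ 2 ^ i) (y ^ 2 ^ i) := by
  simp [wittFrob, witt_coeff]

theorem wittFrob_wittFrob {L : Type*} [CommRing L] [CharP L 2] (i j : ℕ)
    (w : TruncatedWittVector 2 2 L) : wittFrob L i (wittFrob L j w) = wittFrob L (i + j) w := by
  rw [← witt_eta w]
  simp only [wittFrob_apply, ← pow_mul, ← pow_add, add_comm]

theorem wittFrob_zero {L : Type*} [CommRing L] [CharP L 2] (w : TruncatedWittVector 2 2 L) :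
    wittFrob L 0 w = w := by
  rw [← witt_eta w, wittFrob_apply, pow_zero, pow_one, pow_one]

theorem two_nsmul_witt {L : Type*} [CommRing L] [CharP L 2] (x y : L) :
    2 • witt x y = witt 0 (x ^ 2) := by
  rw [two_nsmul, witt_add, CharTwo.add_self_eq_zero, CharTwo.add_self_eq_zero, zero_sub,
    CharTwo.neg_eq, sq]

theorem witt_zero_add {R : Type*} [CommRing R] (x y : R) :
    witt 0 x + witt 0 y = witt 0 (x + y) := by
  rw [witt_add, zero_mul, sub_zero, add_zero]

theorem neg_witt_zero {L : Type*} [CommRing L] [CharP L 2] (x : L) :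
    -witt 0 x = witt 0 x := by
  rw [neg_eq_iff_add_eq_zero, witt_zero_add, CharTwo.add_self_eq_zero, witt_zero]

theorem sum_wittFrob_shift {L : Type*} [CommRing L] [CharP L 2] {M : ℕ}
    {w : TruncatedWittVector 2 2 L} (h : wittFrob L M w = w) (j : ℕ) :
    ∑ i ∈ Finset.range M, wittFrob L i (wittFrob L j w) =
      ∑ i ∈ Finset.range M, wittFrob L i w := by
  induction j with
  | zero => rw [wittFrob_zero]
  | succ j ih =>
    rw [← ih]
    have h1 := Finset.sum_range_succ (fun i => wittFrob L i (wittFrob L j w)) M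
    have h2 := Finset.sum_range_succ' (fun i => wittFrob L i (wittFrob L j w)) M
    rw [h1] at h2
    have h3 : wittFrob L M (wittFrob L j w) = wittFrob L j w := by
      rw [wittFrob_wittFrob, add_comm, ← wittFrob_wittFrob, h]
    rw [h3, wittFrob_zero] at h2
    rw [add_right_cancel h2]
    refine Finset.sum_congr rfl fun i _ => ?_
    simp only [wittFrob_wittFrob]
    congr 2
    omega

theorem sum_range_mul_of_periodic {A : Type*} [AddCommMonoid A] {f : ℕ → A} {M : ℕ}
    (h : ∀ i, f (M + i) = f i) (r : ℕ) :
    ∑ i ∈ Finset.range (r * M), f i = r • ∑ i ∈ Finset.range M, f i := by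
  have h' : ∀ r i, f (r * M + i) = f i := by
    intro r
    induction r with
    | zero => simp
    | succ r ih =>
      intro i
      rw [show (r + 1) * M + i = r * M + (M + i) by ring, ih, h]
  induction r with
  | zero => simp
  | succ r ih =>
    rw [add_mul, one_mul, Finset.sum_range_add, ih, succ_nsmul]
    simp only [h']

theorem sum_wittFrob_mul {L : Type*} [CommRing L] [CharP L 2] {M : ℕ}
    {w : TruncatedWittVector 2 2 L} (h : wittFrob L M w = w) (r : ℕ) :
    ∑ i ∈ Finset.range (r * M), wittFrob L i w =
      r • ∑ i ∈ Finset.range M, wittFrob L i w := by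
  refine sum_range_mul_of_periodic (fun i => ?_) r
  rw [add_comm, ← wittFrob_wittFrob, h]

/-- Pairs the index $i$ with $M+i$; this is transitivity of the trace through a subfield of index
two. -/
theorem sum_wittFrob_two_mul {L : Type*} [CommRing L] [CharP L 2] (M : ℕ)
    (w : TruncatedWittVector 2 2 L) :
    ∑ i ∈ Finset.range (2 * M), wittFrob L i w =
      ∑ i ∈ Finset.range M, wittFrob L i (w + wittFrob L M w) := by
  rw [two_mul, Finset.sum_range_add, ← Finset.sum_add_distrib]
  refine Finset.sum_congr rfl fun i _ => ?_
  rw [map_add, wittFrob_wittFrob, add_comm M i]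

/-! ### Traces and the sign character. -/

/-- The additive character `x ↦ (-1)^{Tr x}` with integral values. -/
def eps (K : Type*) [Field K] [Algebra (ZMod 2) K] : AddChar K ℤ :=
  (AddChar.zmodChar 2 (ζ := (-1 : ℤ)) (by norm_num)).compAddMonoidHom
    (Algebra.trace (ZMod 2) K).toAddMonoidHom

theorem eps_apply (K : Type*) [Field K] [Algebra (ZMod 2) K] (x : K) :
    eps K x = (-1) ^ (Algebra.trace (ZMod 2) K x).val :=
  AddChar.zmodChar_apply (n := 2) (by norm_num) _

section Trace

variable {K : Type*} [Field K] [CharP K 2] [Algebra (ZMod 2) K]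

theorem frobeniusSum_eq (w : TruncatedWittVector 2 2 K) :
    frobeniusSum w = ∑ i ∈ Finset.range (Module.finrank (ZMod 2) K), wittFrob K i w := rfl

theorem frobeniusSum_add (v w : TruncatedWittVector 2 2 K) :
    frobeniusSum (v + w) = frobeniusSum v + frobeniusSum w := by
  simp only [frobeniusSum_eq, map_add, Finset.sum_add_distrib]

/-- Functoriality of `W_2` along `𝔽_2 → 𝔽_q`. -/
def wittMap (K : Type*) [Field K] [Algebra (ZMod 2) K] :
    TruncatedWittVector 2 2 (ZMod 2) →+ TruncatedWittVector 2 2 K where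
  toFun w := witt (algebraMap (ZMod 2) K (w.coeff 0)) (algebraMap (ZMod 2) K (w.coeff 1))
  map_zero' := by simp [TruncatedWittVector.coeff_zero, witt_zero]
  map_add' v w := by
    rw [← witt_eta v, ← witt_eta w, witt_add]
    simp only [witt_coeff, witt_add, map_add, map_sub, map_mul]

theorem wittMap_injective (K : Type*) [Field K] [Algebra (ZMod 2) K] :
    Function.Injective (wittMap K) := by
  intro v w h
  have h' := witt_inj.1 h
  rw [← witt_eta v, ← witt_eta w, (algebraMap (ZMod 2) K).injective h'.1,
    (algebraMap (ZMod 2) K).injective h'.2]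

theorem pow_two_pow_finrank {K : Type*} [Field K] [Algebra (ZMod 2) K] [Finite K] (x : K) :
    x ^ 2 ^ Module.finrank (ZMod 2) K = x := by
  have : Fintype K := Fintype.ofFinite K
  have h := Module.card_eq_pow_finrank (K := ZMod 2) (V := K)
  rw [ZMod.card] at h
  rw [← h]
  exact FiniteField.pow_card x

theorem eps_mul_self (x : K) : eps K x * eps K x = 1 := by
  rw [← AddChar.map_add_eq_mul, CharTwo.add_self_eq_zero, AddChar.map_zero_eq_one]

variable [Finite K]

theorem wittMap_wittTrace (w : TruncatedWittVector 2 2 K) :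
    wittMap K (wittTrace w) = frobeniusSum w := wittTrace_spec w

theorem wittTrace_congr {v w : TruncatedWittVector 2 2 K} (h : frobeniusSum v = frobeniusSum w) :
    wittTrace v = wittTrace w :=
  wittMap_injective K (by simp only [wittMap_wittTrace, h])

theorem wittTrace_add (v w : TruncatedWittVector 2 2 K) :
    wittTrace (v + w) = wittTrace v + wittTrace w :=
  wittMap_injective K (by simp only [map_add, wittMap_wittTrace, frobeniusSum_add])

theorem frobeniusSum_wittFrob (j : ℕ) (w : TruncatedWittVector 2 2 K) :
    frobeniusSum (wittFrob K j w) = frobeniusSum w := by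
  rw [frobeniusSum_eq, frobeniusSum_eq]
  refine sum_wittFrob_shift ?_ j
  rw [← witt_eta w, wittFrob_apply, pow_two_pow_finrank, pow_two_pow_finrank]

theorem frobeniusSum_witt_zero (x : K) :
    frobeniusSum (witt 0 x) = witt 0 (algebraMap (ZMod 2) K (Algebra.trace (ZMod 2) K x)) := by
  rw [FiniteField.algebraMap_trace_eq_sum_pow, frobeniusSum_eq, Nat.card_eq_fintype_card,
    ZMod.card]
  have h : ∀ n, ∑ i ∈ Finset.range n, wittFrob K i (witt 0 x) =
      witt 0 (∑ i ∈ Finset.range n, x ^ 2 ^ i) := by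
    intro n
    induction n with
    | zero => simp [witt_zero]
    | succ n ih =>
      rw [Finset.sum_range_succ, Finset.sum_range_succ, ih, wittFrob_apply,
        zero_pow (by positivity), witt_zero_add]
  exact h _

theorem trace_pow_two_pow (j : ℕ) (x : K) :
    Algebra.trace (ZMod 2) K (x ^ 2 ^ j) = Algebra.trace (ZMod 2) K x := by
  have h := frobeniusSum_wittFrob j (witt 0 x)
  rw [wittFrob_apply, zero_pow (by positivity), frobeniusSum_witt_zero, frobeniusSum_witt_zero]
    at h
  exact (algebraMap (ZMod 2) K).injective (witt_inj.1 h).2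

theorem zmod_two_cases (a : ZMod 2) : a = 0 ∨ a = 1 := by
  revert a
  decide

theorem eps_of_trace_eq (K : Type*) [Field K] [Algebra (ZMod 2) K] {x : K} {j : ℕ}
    (h : Algebra.trace (ZMod 2) K x = j) : eps K x = (-1) ^ j := by
  rw [eps_apply, h, ZMod.val_natCast, ← pow_eq_pow_mod j (by norm_num)]

theorem eps_eq_one_iff (K : Type*) [Field K] [Algebra (ZMod 2) K] (x : K) :
    eps K x = 1 ↔ Algebra.trace (ZMod 2) K x = 0 := by
  rcases zmod_two_cases (Algebra.trace (ZMod 2) K x) with h | h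
  · simp [h, eps_of_trace_eq K (j := 0) (x := x) (by simpa using h)]
  · simp [h, eps_of_trace_eq K (j := 1) (x := x) (by simpa using h)]

theorem eps_eq_neg_one_pow_iff (K : Type*) [Field K] [Algebra (ZMod 2) K] (x : K) (j : ℕ) :
    eps K x = (-1) ^ j ↔ Algebra.trace (ZMod 2) K x = j := by
  refine ⟨fun h => ?_, eps_of_trace_eq K⟩
  rw [← sub_eq_zero]
  rcases zmod_two_cases (Algebra.trace (ZMod 2) K x - j) with h0 | h0
  · exact h0
  · have h1 := eps_of_trace_eq K (x := x) (j := j + 1) (by push_cast; rw [← h0]; ring)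
    rw [h, pow_succ] at h1
    have : ((-1 : ℤ) ^ j) ≠ 0 := by positivity
    omega

theorem eps_pow_two_pow (j : ℕ) (x : K) : eps K (x ^ 2 ^ j) = eps K x := by
  rw [eps_apply, eps_apply, trace_pow_two_pow]

theorem eps_sq (x : K) : eps K (x ^ 2) = eps K x := eps_pow_two_pow 1 x

end Trace

/-! ### The quadratic function $Q_q$ and its special values. -/

section Characters

variable {K : Type*} [Field K] [CharP K 2] [Algebra (ZMod 2) K] [Finite K]
  {Ω : Type*} [Field Ω] {I : Ω} (hI : IsPrimitiveRoot I 4)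

theorem xi2_wittTrace_of_frobeniusSum {w : TruncatedWittVector 2 2 K} {j : ℕ}
    (h : frobeniusSum w = j • witt 1 0) : xi2 hI (wittTrace w) = I ^ j := by
  have hw : wittTrace w = j • witt 1 0 := by
    apply wittMap_injective K
    rw [wittMap_wittTrace, h, map_nsmul]
    simp [wittMap, witt_coeff]
  rw [hw, AddChar.map_nsmul_eq_pow, xi2_one]

theorem sq_eq_neg_one_of_isPrimitiveRoot (hI : IsPrimitiveRoot I 4) : I ^ 2 = -1 :=
  (hI.pow (by norm_num) (show 4 = 2 * 2 by norm_num)).eq_neg_one_of_two_right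

/-- In $W_2(\mathbb F_2)$ the vector $(0,1)$ is twice $(1,0)$, so its character value is $I^2=-1$.
-/
theorem psiq_eq_eps (x : K) : psiq hI x = (eps K x : Ω) := by
  rw [psiq]
  rcases zmod_two_cases (Algebra.trace (ZMod 2) K x) with h | h
  · rw [xi2_wittTrace_of_frobeniusSum hI (j := 0), (eps_eq_one_iff K x).2 h]
    · simp
    · rw [frobeniusSum_witt_zero, h, map_zero, witt_zero, zero_nsmul]
  · rw [xi2_wittTrace_of_frobeniusSum hI (j := 2), eps_of_trace_eq K (j := 1) (by simpa using h)]
    · simp [sq_eq_neg_one_of_isPrimitiveRoot hI]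
    · rw [frobeniusSum_witt_zero, h, map_one, two_nsmul_witt, one_pow]

theorem Qq_add (x y : K) : Qq hI (x + y) = Qq hI x * Qq hI y * eps K (x * y) := by
  rw [← psiq_eq_eps hI, Qq, Qq, Qq, psiq, ← AddChar.map_add_eq_mul, ← AddChar.map_add_eq_mul,
    ← wittTrace_add, ← wittTrace_add, witt_add, witt_add]
  congr 2
  rw [witt_inj]
  constructor
  · ring
  · rw [CharTwo.sub_eq_add]
    ring

theorem Qq_pow_two_pow (j : ℕ) (x : K) : Qq hI (x ^ 2 ^ j) = Qq hI x := by
  rw [Qq, Qq, wittTrace_congr]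
  rw [← frobeniusSum_wittFrob j (witt x 0), wittFrob_apply, zero_pow (by positivity)]

theorem Qq_zero : Qq hI (0 : K) = 1 := by
  have h := psiq_eq_eps hI (0 : K)
  rwa [AddChar.map_zero_eq_one, Int.cast_one] at h

/-- Both traces are $n$ times a sum over $2M$ Frobenius powers. Pairing $i$ with $M+i$ turns $(v,0)$
into $2(v,0)=(0,v^2)$ and $(0,tv)$ into $(0,v)$, and these have the same Frobenius sum. -/
theorem Qq_eq_eps_of_fixed {M n : ℕ} (hN : Module.finrank (ZMod 2) K = 2 * n * M) {t v : K}
    (ht : t ^ 2 ^ M + t = 1) (hv : v ^ 2 ^ M = v) : Qq hI v = eps K (t * v) := by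
  rw [← psiq_eq_eps hI, Qq, psiq, wittTrace_congr]
  have ht' : t ^ 2 ^ M = t + 1 := by
    rw [← ht, add_comm, add_assoc, CharTwo.add_self_eq_zero, add_zero]
  have ht2 : (t ^ 2 ^ M) ^ 2 ^ M = t := by
    rw [ht', add_pow_char_pow, ht', one_pow, add_assoc, CharTwo.add_self_eq_zero, add_zero]
  have h0 : (0 : K) ^ 2 ^ M = 0 := zero_pow (by positivity)
  have hfix : wittFrob K (2 * M) (witt 0 (t * v)) = witt 0 (t * v) := by
    rw [two_mul, ← wittFrob_wittFrob, wittFrob_apply, wittFrob_apply, mul_pow, mul_pow, ht2, hv,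
      hv, h0, h0]
  have hfix' : wittFrob K M (witt v 0) = witt v 0 := by rw [wittFrob_apply, hv, h0]
  have hfix'' : wittFrob K M (witt 0 v) = witt 0 v := by rw [wittFrob_apply, hv, h0]
  rw [frobeniusSum_eq, frobeniusSum_eq, hN, sum_wittFrob_mul hfix',
    show 2 * n * M = n * (2 * M) by ring, sum_wittFrob_mul hfix, sum_wittFrob_two_mul,
    wittFrob_apply, h0, witt_zero_add, mul_pow, hv, ht', ← add_mul, ← add_assoc,
    CharTwo.add_self_eq_zero, zero_add, one_mul, mul_comm 2 n, mul_smul, Finset.smul_sum (r := 2),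
    ← sum_wittFrob_shift hfix'' 1]
  congr 1
  refine Finset.sum_congr rfl fun i _ => ?_
  rw [← map_nsmul, two_nsmul_witt, wittFrob_apply 1, zero_pow (by positivity), pow_one]

/-- Here $(t,0)+(t+1,0)=(1,0)+(0,t^2)-(0,t)$. Over $M$ Frobenius powers the last difference
telescopes to $(0,1)=2$, so the total trace is $n(M+2)$. -/
theorem Qq_of_pow_add_eq_one {M n : ℕ} (hN : Module.finrank (ZMod 2) K = 2 * n * M) {t : K}
    (ht : t ^ 2 ^ M + t = 1) : Qq hI t = (-1) ^ n * I ^ (n * M) := by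
  have ht' : t ^ 2 ^ M = t + 1 := by
    rw [← ht, add_comm, add_assoc, CharTwo.add_self_eq_zero, add_zero]
  have ht2 : (t ^ 2 ^ M) ^ 2 ^ M = t := by
    rw [ht', add_pow_char_pow, ht', one_pow, add_assoc, CharTwo.add_self_eq_zero, add_zero]
  have h0 : (0 : K) ^ 2 ^ M = 0 := zero_pow (by positivity)
  have hfix : wittFrob K (2 * M) (witt t 0) = witt t 0 := by
    rw [two_mul, ← wittFrob_wittFrob, wittFrob_apply, wittFrob_apply, ht2, h0, h0]
  have hsum : witt t 0 + wittFrob K M (witt t 0) =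
      witt 1 0 + (wittFrob K 1 (witt 0 t) - witt 0 t) := by
    rw [wittFrob_apply, wittFrob_apply, h0, sub_eq_add_neg, neg_witt_zero,
      zero_pow (by positivity), witt_zero_add, witt_add, witt_add, ht', witt_inj]
    constructor
    · rw [← add_assoc, CharTwo.add_self_eq_zero, zero_add, add_zero]
    · rw [CharTwo.sub_eq_add, CharTwo.sub_eq_add]
      ring
  have htel : ∑ i ∈ Finset.range M, wittFrob K i (wittFrob K 1 (witt 0 t) - witt 0 t) =
      2 • witt 1 0 := by
    have h := Finset.sum_range_sub (fun i => wittFrob K i (witt 0 t)) M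
    simp only [map_sub, wittFrob_wittFrob]
    rw [h, wittFrob_zero, wittFrob_apply, h0, sub_eq_add_neg, neg_witt_zero, witt_zero_add, ht,
      two_nsmul_witt, one_pow]
  have hone : ∑ i ∈ Finset.range M, wittFrob K i (witt 1 0) = M • witt 1 0 := by
    simp [wittFrob_apply]
  have key : frobeniusSum (witt t 0) = (n * (M + 2)) • witt 1 0 := by
    rw [frobeniusSum_eq, hN, show 2 * n * M = n * (2 * M) by ring, sum_wittFrob_mul hfix,
      sum_wittFrob_two_mul, hsum]
    simp only [map_add, Finset.sum_add_distrib]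
    rw [htel, hone, ← add_nsmul, mul_nsmul']
  rw [Qq, xi2_wittTrace_of_frobeniusSum hI key, mul_add, pow_add, mul_comm n 2, pow_mul I 2,
    sq_eq_neg_one_of_isPrimitiveRoot hI, mul_comm]

theorem eps_eq_one_of_fixed {M n : ℕ} (hN : Module.finrank (ZMod 2) K = 2 * n * M) {v : K}
    (hv : v ^ 2 ^ M = v) : eps K v = 1 := by
  have hfix : wittFrob K M (witt 0 v) = witt 0 v := by
    rw [wittFrob_apply, hv, zero_pow (by positivity)]
  have h := frobeniusSum_witt_zero v
  rw [frobeniusSum_eq, hN, sum_wittFrob_mul hfix, mul_comm 2 n, mul_smul, Finset.smul_sum,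
    Finset.sum_congr rfl fun i _ => by rw [← map_nsmul, two_nsmul_witt, zero_pow (by norm_num),
      witt_zero, map_zero], Finset.sum_const_zero, smul_zero, ← witt_zero, witt_inj] at h
  rw [eps_eq_one_iff]
  exact (algebraMap (ZMod 2) K).injective (by rw [← h.2, map_zero])

end Characters

/-! ### Fibres of additive maps and duality for the trace form. -/

section Fibers

variable {K : Type*} [AddCommGroup K]

theorem card_fiber_of_mem_range [Fintype K] [DecidableEq K] (f : K →+ K) {c : K}
    (hc : c ∈ f.range) : (Finset.univ.filter fun x => f x = c).card = Nat.card f.ker := by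
  rw [AddMonoidHom.card_fiber_eq_of_mem_range f hc (y := 0) ⟨0, map_zero f⟩,
    ← Fintype.card_subtype, ← Nat.card_eq_fintype_card]
  rfl

theorem sum_comp_addMonoidHom [Fintype K] {A : Type*} [Ring A] (f : K →+ K)
    [DecidablePred (· ∈ f.range)] (φ : K → A) :
    ∑ x, φ (f x) = Nat.card f.ker * ∑ s, (if s ∈ f.range then φ s else 0) := by
  classical
  rw [← Finset.sum_fiberwise Finset.univ f, Finset.mul_sum]
  refine Finset.sum_congr rfl fun s _ => ?_
  rw [Finset.sum_congr rfl (g := fun _ => φ s) fun x hx => by rw [(Finset.mem_filter.1 hx).2],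
    Finset.sum_const]
  split_ifs with hs
  · rw [card_fiber_of_mem_range f hs, nsmul_eq_mul]
  · rw [Finset.filter_false_of_mem fun x _ hx => hs ⟨x, hx⟩]
    simp

theorem card_range_mul_card_ker [Finite K] (f : K →+ K) :
    Nat.card f.range * Nat.card f.ker = Nat.card K := by
  rw [← AddSubgroup.index_ker, mul_comm, AddSubgroup.card_mul_index]

end Fibers

section Duality

variable {K : Type*} [Field K] [Algebra (ZMod 2) K]

/-- `f` and `g` are adjoint for the trace form of `K` over `𝔽_2`. -/
def TraceAdjoint (f g : K →+ K) : Prop :=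
  ∀ x y, Algebra.trace (ZMod 2) K (f x * y) = Algebra.trace (ZMod 2) K (x * g y)

theorem TraceAdjoint.eps_eq {f g : K →+ K} (h : TraceAdjoint f g) (x y : K) :
    eps K (f x * y) = eps K (x * g y) := by
  rw [eps_apply, eps_apply, h]

/-- The orthogonal of the range of $f$ is $\ker g$, and nondegeneracy of the trace form makes the
range equal to its double orthogonal. -/
theorem TraceAdjoint.mem_range_iff [Finite K] {f g : K →+ K} (h : TraceAdjoint f g) (c : K) :
    c ∈ f.range ↔ ∀ v, g v = 0 → eps K (c * v) = 1 := by
  constructor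
  · rintro ⟨x, rfl⟩ v hv
    rw [h.eps_eq, hv, mul_zero, AddChar.map_zero_eq_one]
  · intro hc
    let B := Algebra.traceForm (ZMod 2) K
    let U := (f.toZModLinearMap 2).range
    have hB : B.Nondegenerate := traceForm_nondegenerate (ZMod 2) K
    have hsymm : B.IsSymm := Algebra.traceForm_isSymm (ZMod 2)
    have hmem : c ∈ B.orthogonal (B.orthogonal U) := by
      intro v hv
      have hgv : g v = 0 := by
        by_contra hne
        apply hne
        refine hB.1 _ fun x => ?_
        have h1 : Algebra.trace (ZMod 2) K (f x * v) = 0 := hv (f x) ⟨x, rfl⟩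
        rw [h] at h1
        rw [Algebra.traceForm_apply, mul_comm]
        exact h1
      have h2 := (eps_eq_one_iff K _).1 (hc v hgv)
      rw [mul_comm] at h2
      exact h2
    rw [LinearMap.BilinForm.orthogonal_orthogonal hB hsymm.isRefl] at hmem
    obtain ⟨x, hx⟩ := hmem
    exact ⟨x, hx⟩

theorem TraceAdjoint.sum_ker_eps [Finite K] {f g : K →+ K} (h : TraceAdjoint f g)
    [Fintype g.ker] [DecidablePred (· ∈ f.range)] (c : K) :
    ∑ v : g.ker, eps K (c * v) = if c ∈ f.range then (Nat.card g.ker : ℤ) else 0 := by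
  classical
  let χ : AddChar g.ker ℤ :=
    (eps K).compAddMonoidHom ((AddMonoidHom.mulLeft c).comp g.ker.subtype)
  have hχ : ∀ v : g.ker, χ v = eps K (c * v) := fun v => rfl
  have hiff : χ = 0 ↔ c ∈ f.range := by
    rw [h.mem_range_iff]
    constructor
    · intro h0 v hv
      rw [← hχ ⟨v, hv⟩, h0, AddChar.zero_apply]
    · intro h1
      ext v
      rw [hχ, AddChar.zero_apply, h1 v v.2]
  simp only [← hχ]
  rw [AddChar.sum_eq_ite, Nat.card_eq_fintype_card]
  simp only [hiff]

end Duality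

/-! ### The maps $x\mapsto x^{2^M}+x$ and their adjoints. -/

section ArtinSchreier

variable {K : Type*} [Field K] [CharP K 2]

/-- The map `x ↦ x^{2^M} + x`. -/
def artinSchreier (K : Type*) [Field K] [CharP K 2] (M : ℕ) : K →+ K :=
  (iterateFrobenius K 2 M : K →+ K) + AddMonoidHom.id K

theorem artinSchreier_apply (M : ℕ) (x : K) : artinSchreier K M x = x ^ 2 ^ M + x := rfl

theorem artinSchreier_eq_zero {M : ℕ} {x : K} : artinSchreier K M x = 0 ↔ x ^ 2 ^ M = x := by
  rw [artinSchreier_apply, CharTwo.add_eq_zero]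

/-- The map `x ↦ x^{2^{-M}} + x`. -/
def artinSchreierAdj (K : Type*) [Field K] [CharP K 2] [PerfectRing K 2] (M : ℕ) : K →+ K :=
  ((iterateFrobeniusEquiv K 2 M).symm : K →+ K) + AddMonoidHom.id K

theorem artinSchreierAdj_eq_zero [PerfectRing K 2] {M : ℕ} {x : K} :
    artinSchreierAdj K M x = 0 ↔ x ^ 2 ^ M = x := by
  have h : artinSchreierAdj K M x = (iterateFrobeniusEquiv K 2 M).symm x + x := rfl
  rw [h, CharTwo.add_eq_zero, RingEquiv.symm_apply_eq, iterateFrobeniusEquiv_def, eq_comm]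

theorem ker_artinSchreierAdj [PerfectRing K 2] (M : ℕ) :
    (artinSchreierAdj K M).ker = (artinSchreier K M).ker := by
  ext x
  rw [AddMonoidHom.mem_ker, AddMonoidHom.mem_ker, artinSchreier_eq_zero,
    artinSchreierAdj_eq_zero]

end ArtinSchreier

theorem card_eq_two_pow_finrank (K : Type*) [Field K] [Algebra (ZMod 2) K] [Finite K] : Nat.card K = 2 ^ Module.finrank (ZMod 2) K := by
  rw [Module.natCard_eq_pow_finrank (K := ZMod 2) (V := K), Nat.card_zmod]

/-! ### The Gauss sum of $Q_q$. -/

section GaussSum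

variable {K : Type*} [Field K] [CharP K 2] [Algebra (ZMod 2) K] [Fintype K]
  {Ω : Type*} [Field Ω] [CharZero Ω] {I : Ω} (hI : IsPrimitiveRoot I 4)

/-- The range of $f$ is detected by averaging $\psi(sv)$ over $v\in\ker g$. The condition on $t$
gives $Q(t+s)\psi(sv)=Q(s+t+v)$, so each $v$ contributes a translate of the complete sum. -/
theorem sum_Qq_add_range {f g : K →+ K} (h : TraceAdjoint f g) {t : K}
    (ht : ∀ v, g v = 0 → Qq hI v = eps K (t * v)) :
    ∑ x, Qq hI (t + f x) = Nat.card f.ker * ∑ s : K, Qq hI s := by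
  classical
  have : Fintype g.ker := Fintype.ofFinite _
  have hne : (Nat.card g.ker : Ω) ≠ 0 := Nat.cast_ne_zero.2 Nat.card_pos.ne'
  rw [sum_comp_addMonoidHom f fun s => Qq hI (t + s)]
  congr 1
  apply mul_left_cancel₀ hne
  rw [Finset.mul_sum]
  have h1 : ∀ s : K, (Nat.card g.ker : Ω) * (if s ∈ f.range then Qq hI (t + s) else 0) =
      ∑ v : g.ker, Qq hI (s + (t + v)) := by
    intro s
    have h2 : ∀ v : g.ker, Qq hI (s + (t + v)) = Qq hI (t + s) * (eps K (s * v) : ℤ) := by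
      intro v
      rw [← add_assoc, add_comm s t, Qq_add hI (t + s), ht v v.2, add_mul, AddChar.map_add_eq_mul]
      push_cast
      have h3 := eps_mul_self (t * (v : K))
      rw [← @Int.cast_inj Ω] at h3
      push_cast at h3
      linear_combination Qq hI (t + s) * (eps K (s * v) : Ω) * h3
    rw [Finset.sum_congr rfl fun v _ => h2 v, ← Finset.mul_sum, ← Int.cast_sum, h.sum_ker_eps]
    split_ifs <;> simp [mul_comm]
  rw [Finset.sum_congr rfl fun s _ => h1 s, Finset.sum_comm]
  have h4 : ∀ v : g.ker, ∑ s : K, Qq hI (s + (t + v)) = ∑ s : K, Qq hI s := fun v =>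
    Fintype.sum_equiv (Equiv.addRight (t + (v : K))) _ _ fun s => rfl
  simp [h4]

theorem traceAdjoint_artinSchreier (M : ℕ) :
    TraceAdjoint (artinSchreier K M) (artinSchreierAdj K M) := by
  intro x y
  have h : artinSchreierAdj K M y = (iterateFrobeniusEquiv K 2 M).symm y + y := rfl
  have h' : (iterateFrobeniusEquiv K 2 M).symm y ^ 2 ^ M = y := by
    rw [← iterateFrobeniusEquiv_def, RingEquiv.apply_symm_apply]
  rw [h, artinSchreier_apply, add_mul, mul_add, map_add, map_add,
    ← trace_pow_two_pow M (x * (iterateFrobeniusEquiv K 2 M).symm y), mul_pow, h']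

theorem exists_pow_add_eq_one {M n : ℕ} (hN : Module.finrank (ZMod 2) K = 2 * n * M) :
    ∃ t : K, t ^ 2 ^ M + t = 1 := by
  refine ((traceAdjoint_artinSchreier (K := K) M).mem_range_iff 1).2 fun v hv => ?_
  rw [one_mul]
  exact eps_eq_one_of_fixed hN (artinSchreierAdj_eq_zero.1 hv)

/-- When $2^M=\sqrt q$, image and kernel are both the fixed field of $x\mapsto x^{2^M}$, so
$|\ker|^2=q$. -/
theorem card_ker_artinSchreier_half {M : ℕ} (hN : Module.finrank (ZMod 2) K = 2 * M) :
    Nat.card (artinSchreier K M).ker = 2 ^ M := by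
  have hN1 : Module.finrank (ZMod 2) K = 2 * 1 * M := by rw [hN, mul_one]
  have hrk : (artinSchreier K M).range = (artinSchreier K M).ker := by
    ext c
    rw [AddMonoidHom.mem_ker, artinSchreier_eq_zero]
    constructor
    · rintro ⟨x, rfl⟩
      rw [artinSchreier_apply, add_pow_char_pow, ← pow_mul, ← pow_add, ← two_mul, ← hN,
        pow_two_pow_finrank, add_comm]
    · intro hc
      refine ((traceAdjoint_artinSchreier M).mem_range_iff c).2 fun v hv => ?_
      refine eps_eq_one_of_fixed hN1 ?_
      rw [mul_pow, hc, artinSchreierAdj_eq_zero.1 hv]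
  have h := card_range_mul_card_ker (artinSchreier K M)
  rw [hrk, card_eq_two_pow_finrank K, hN, two_mul, pow_add] at h
  exact Nat.mul_self_inj.1 h

/-- Solutions of $t^{\sqrt q}+t=1$ form a coset of the range of $x\mapsto x^{\sqrt q}+x$, on which
$Q$ is constantly $-I^M$. Comparing this with `sum_Qq_add_range` yields the full sum. -/
theorem sum_Qq {M : ℕ} (hN : Module.finrank (ZMod 2) K = 2 * M) :
    ∑ s : K, Qq hI s = -(2 ^ M * I ^ M) := by
  have hN1 : Module.finrank (ZMod 2) K = 2 * 1 * M := by rw [hN, mul_one]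
  obtain ⟨t, ht⟩ := exists_pow_add_eq_one hN1
  have h := sum_Qq_add_range hI (traceAdjoint_artinSchreier M) (t := t) fun v hv =>
    Qq_eq_eps_of_fixed hI hN1 ht (artinSchreierAdj_eq_zero.1 hv)
  have hQ : ∀ x : K, Qq hI (t + artinSchreier K M x) = -I ^ M := by
    intro x
    rw [Qq_of_pow_add_eq_one hI hN1 (t := t + artinSchreier K M x), pow_one, one_mul, neg_one_mul]
    rw [artinSchreier_apply, add_pow_char_pow, add_pow_char_pow, ← pow_mul, ← pow_add, ← two_mul,
      ← hN, pow_two_pow_finrank]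
    linear_combination ht + (x + x ^ 2 ^ M) * CharTwo.two_eq_zero (R := K)
  rw [Finset.sum_congr rfl fun x _ => hQ x, Finset.sum_const, Finset.card_univ,
    ← Nat.card_eq_fintype_card, card_eq_two_pow_finrank, hN, card_ker_artinSchreier_half hN,
    nsmul_eq_mul, two_mul, pow_add] at h
  push_cast at h
  have h2 : (2 : Ω) ^ M ≠ 0 := pow_ne_zero M two_ne_zero
  apply mul_left_cancel₀ h2
  rw [← h]
  ring

end GaussSum

/-! ### Additive polynomials, their adjoints and base change. -/

section Additive

variable {L : Type*} [Field L] [CharP L 2]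

theorem add_pow_pow (m i : ℕ) (x y : L) :
    (x + y) ^ (2 ^ m) ^ i = x ^ (2 ^ m) ^ i + y ^ (2 ^ m) ^ i := by
  rw [← pow_mul, add_pow_char_pow]

/-- `F` as an additive map. -/
def linFHom (m e : ℕ) (b : ℕ → L) : L →+ L where
  toFun := linF m e b
  map_zero' := Finset.sum_eq_zero fun i _ => by rw [zero_pow (by positivity), mul_zero]
  map_add' x y := by
    simp only [linF, add_pow_pow, mul_add, Finset.sum_add_distrib]

theorem evalR_mul {L : Type*} [Field L] (m e : ℕ) (c : ℕ → L) {μ : L} (hμ : μ ^ 2 ^ m = μ) (x : L) :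
    evalR m e c (μ * x) = μ * evalR m e c x := by
  have h : ∀ i, μ ^ (2 ^ m) ^ i = μ := by
    intro i
    induction i with
    | zero => rw [pow_zero, pow_one]
    | succ i ih => rw [pow_succ, pow_mul, ih, hμ]
  rw [evalR, evalR, Finset.mul_sum]
  refine Finset.sum_congr rfl fun i _ => ?_
  rw [mul_pow, h]
  ring

variable [PerfectRing L 2]

theorem root_add (m i : ℕ) (x y : L) : root m i (x + y) = root m i x + root m i y :=
  map_add (iterateFrobeniusEquiv L 2 (m * i)).symm x y

theorem root_unique {m i : ℕ} {x y : L} (h : y ^ (2 ^ m) ^ i = x) : root m i x = y := by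
  rw [root, RingEquiv.symm_apply_eq, iterateFrobeniusEquiv_def, ← h, pow_mul]

/-- `F^*` as an additive map. -/
def adjFHom (m e : ℕ) (b : ℕ → L) : L →+ L where
  toFun := adjF m e b
  map_zero' := Finset.sum_eq_zero fun i _ => by rw [mul_zero]; exact map_zero _
  map_add' x y := by
    simp only [adjF, mul_add, root_add, Finset.sum_add_distrib]

/-- `E_F` as an additive map. -/
def EFHom (m e : ℕ) (b : ℕ → L) : L →+ L := (adjFHom m e b).comp (linFHom m e b)

theorem adjF_one_mul (m e : ℕ) (b : ℕ → L) (x : L) :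
    adjF m e b 1 * x = ∑ i ∈ Finset.range (e + 1), root m i (b i) * x := by
  simp only [adjF, mul_one, Finset.sum_mul]

end Additive

section Extension

variable {K L : Type*} [Field K] [CharP K 2] [PerfectRing K 2] [Field L] [CharP L 2]
  [PerfectRing L 2] [Algebra K L]

theorem root_algebraMap (m i : ℕ) (x : K) :
    root m i (algebraMap K L x) = algebraMap K L (root m i x) := by
  apply root_unique
  rw [← map_pow, root_pow]

theorem linF_algebraMap {K L : Type*} [Field K] [Field L] [Algebra K L] (m e : ℕ) (b : ℕ → K)
    (x : K) :
    linF m e (fun i => algebraMap K L (b i)) (algebraMap K L x) = algebraMap K L (linF m e b x) := by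
  simp only [linF, map_sum, map_mul, map_pow]

theorem adjF_algebraMap (m e : ℕ) (b : ℕ → K) (x : K) :
    adjF m e (fun i => algebraMap K L (b i)) (algebraMap K L x) = algebraMap K L (adjF m e b x) := by
  simp only [adjF, ← map_mul, root_algebraMap, map_sum]

end Extension

/-! ### Counting rational roots of additive polynomials. -/

section RootCount

open Polynomial

/-- `F` as a polynomial. -/
def linPoly {L : Type*} [Field L] (m e : ℕ) (b : ℕ → L) : L[X] :=
  ∑ i ∈ Finset.range (e + 1), C (b i) * X ^ (2 ^ m) ^ i

variable {L : Type*} [Field L]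

theorem natDegree_linPoly {m e : ℕ} (hm : 0 < m) {b : ℕ → L} (hb : b e ≠ 0) :
    (linPoly m e b).natDegree = (2 ^ m) ^ e := by
  have h1 : 1 < 2 ^ m := Nat.one_lt_two_pow hm.ne'
  rw [linPoly, Finset.sum_range_succ, natDegree_add_eq_right_of_degree_lt, natDegree_C_mul_X_pow _ _ hb]
  rw [degree_C_mul_X_pow _ hb]
  refine (degree_sum_le _ _).trans_lt ((Finset.sup_lt_iff ?_).2 fun i hi => ?_)
  · exact WithBot.bot_lt_coe _
  · refine (degree_C_mul_X_pow_le _ _).trans_lt ?_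
    exact_mod_cast Nat.pow_lt_pow_right h1 (Finset.mem_range.1 hi)

theorem separable_linPoly [CharP L 2] {m e : ℕ} (hm : 0 < m) {b : ℕ → L} (hb : b 0 ≠ 0) :
    (linPoly m e b).Separable := by
  have hd : derivative (linPoly m e b) = C (b 0) := by
    rw [linPoly, Finset.sum_range_succ', derivative_add, derivative_sum, Finset.sum_eq_zero]
    · simp
    · intro i _
      rw [derivative_C_mul, derivative_X_pow]
      have : (((2 ^ m) ^ (i + 1) : ℕ) : L) = 0 := by
        rw [CharP.cast_eq_zero_iff L 2]
        exact (dvd_pow_self 2 hm.ne').trans (dvd_pow_self _ (Nat.succ_ne_zero i))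
      rw [this, C_0, zero_mul, mul_zero]
  rw [Polynomial.separable_def, hd]
  exact ⟨0, C (b 0)⁻¹, by rw [zero_mul, zero_add, ← C_mul, inv_mul_cancel₀ hb, C_1]⟩

theorem aeval_linPoly {A : Type*} [Field A] [Algebra L A] (m e : ℕ) (b : ℕ → L) (x : A) :
    aeval x (linPoly m e b) = linF m e (fun i => algebraMap L A (b i)) x := by
  simp [linPoly, linF, map_sum]

/-- The polynomial has constant derivative $b_0\ne0$, hence $p^e$ distinct roots, all of them
rational. -/
theorem card_ker_linFHom [CharP L 2] {m e : ℕ} (hm : 0 < m) {b : ℕ → L} (h0 : b 0 ≠ 0)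
    (he : b e ≠ 0)
    (h : ∀ x : AlgebraicClosure L, linF m e (fun i => algebraMap L (AlgebraicClosure L) (b i)) x = 0 →
      x ∈ Set.range (algebraMap L (AlgebraicClosure L))) :
    Nat.card (linFHom m e b).ker = (2 ^ m) ^ e := by
  have hP : linPoly m e b ≠ 0 := (separable_linPoly hm h0).ne_zero
  rw [← natDegree_linPoly hm he, ← card_rootSet_eq_natDegree (K := AlgebraicClosure L)
    (separable_linPoly hm h0) (IsAlgClosed.splits _), ← Nat.card_eq_fintype_card]
  refine Nat.card_congr (Equiv.ofBijective (fun x => ⟨algebraMap L (AlgebraicClosure L) x.1, ?_⟩)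
    ⟨fun x y hxy => ?_, fun y => ?_⟩)
  · rw [mem_rootSet_of_ne hP, aeval_linPoly, linF_algebraMap]
    rw [show linF m e b x.1 = 0 from x.2, map_zero]
  · exact Subtype.ext ((algebraMap L (AlgebraicClosure L)).injective (Subtype.ext_iff.1 hxy))
  · have hy := (mem_rootSet_of_ne hP).1 y.2
    rw [aeval_linPoly] at hy
    obtain ⟨x, hx⟩ := h y hy
    refine ⟨⟨x, (algebraMap L (AlgebraicClosure L)).injective ?_⟩, Subtype.ext hx⟩
    rw [map_zero, ← hy, ← hx]
    exact (linF_algebraMap m e b x).symm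

theorem mem_range_algebraMap_of_pow_card {A : Type*} [Field A] [Algebra L A] [Finite L] {x : A}
    (hx : x ^ Nat.card L = x) : x ∈ Set.range (algebraMap L A) := by
  have : Fintype L := Fintype.ofFinite L
  rw [Nat.card_eq_fintype_card] at hx
  have hsplit : (X ^ Fintype.card L - X : L[X]).Splits := by
    rw [splits_iff_card_roots, FiniteField.roots_X_pow_card_sub_X, ← Finset.card_def,
      Finset.card_univ, FiniteField.X_pow_card_sub_X_natDegree_eq _ Fintype.one_lt_card]
  refine hsplit.mem_range_of_isRoot ?_ ?_
  · exact FiniteField.X_pow_card_sub_X_ne_zero L Fintype.one_lt_card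
  · simp [hx]

theorem card_ker_artinSchreier [CharP L 2] [Algebra (ZMod 2) L] [Finite L] {m : ℕ} (hm : 0 < m)
    (hdvd : m ∣ Module.finrank (ZMod 2) L) : Nat.card (artinSchreier L m).ker = 2 ^ m := by
  have hlin : ∀ {A : Type _} [Field A] (x : A), linF m 1 (fun _ => 1) x = x ^ 2 ^ m + x := by
    intro A _ x
    simp [linF, Finset.sum_range_succ, add_comm]
  have h := card_ker_linFHom (L := L) (e := 1) hm (b := fun _ => 1) one_ne_zero one_ne_zero ?_
  · rw [pow_one] at h
    rw [← h]
    congr 2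
    ext x
    rw [AddMonoidHom.mem_ker, AddMonoidHom.mem_ker, artinSchreier_apply, ← hlin]
    rfl
  · intro x hx
    simp only [map_one] at hx
    rw [hlin, CharTwo.add_eq_zero] at hx
    apply mem_range_algebraMap_of_pow_card
    obtain ⟨r, hr⟩ := hdvd
    rw [card_eq_two_pow_finrank, hr, pow_mul]
    clear hr
    induction r with
    | zero => rw [pow_zero, pow_one]
    | succ r ih => rw [pow_succ, pow_mul, ih, hx]

end RootCount

/-! ### The pullback of $Q_q$ along $F$. -/

section Forms

variable {K : Type*} [Field K] [CharP K 2] [Algebra (ZMod 2) K] [Finite K]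

theorem trace_pow_pow (m i : ℕ) (x : K) :
    Algebra.trace (ZMod 2) K (x ^ (2 ^ m) ^ i) = Algebra.trace (ZMod 2) K x := by
  rw [← pow_mul, trace_pow_two_pow]

theorem trace_root_mul (m i : ℕ) (x y : K) :
    Algebra.trace (ZMod 2) K (root m i x * y) =
      Algebra.trace (ZMod 2) K (x * y ^ (2 ^ m) ^ i) := by
  rw [← trace_pow_pow m i (root m i x * y), mul_pow, root_pow]

theorem traceAdjoint_linF (m e : ℕ) (b : ℕ → K) :
    TraceAdjoint (linFHom m e b) (adjFHom m e b) := by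
  intro x y
  change Algebra.trace (ZMod 2) K (linF m e b x * y) = Algebra.trace (ZMod 2) K (x * adjF m e b y)
  rw [linF, adjF, Finset.sum_mul, Finset.mul_sum, map_sum, map_sum]
  refine Finset.sum_congr rfl fun i _ => ?_
  rw [mul_comm x, trace_root_mul]
  congr 1
  ring

theorem traceAdjoint_EF (m e : ℕ) (b : ℕ → K) :
    TraceAdjoint (EFHom m e b) (EFHom m e b) := by
  intro x y
  have h := traceAdjoint_linF m e b
  change Algebra.trace (ZMod 2) K (adjFHom m e b (linFHom m e b x) * y) =
    Algebra.trace (ZMod 2) K (x * adjFHom m e b (linFHom m e b y))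
  rw [← h, mul_comm, ← h, mul_comm]

/-- Under the trace, the cross term of indices $i$ and $i+d$ may be replaced by its $p^i$-th root;
collecting by $d$ produces the coefficients $a_d$. -/
theorem trace_sum_lt (m e : ℕ) (b : ℕ → K) (x : K) :
    Algebra.trace (ZMod 2) K (∑ j ∈ Finset.range (e + 1), ∑ i ∈ Finset.range j,
      b i * x ^ (2 ^ m) ^ i * (b j * x ^ (2 ^ m) ^ j)) =
    Algebra.trace (ZMod 2) K (x * evalR m e (coeffRF m e b) x) := by
  have hterm : ∀ d i : ℕ, Algebra.trace (ZMod 2) K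
      (b i * x ^ (2 ^ m) ^ i * (b (i + d) * x ^ (2 ^ m) ^ (i + d))) =
      Algebra.trace (ZMod 2) K (x * (root m i (b i * b (i + d)) * x ^ (2 ^ m) ^ d)) := by
    intro d i
    rw [show x * (root m i (b i * b (i + d)) * x ^ (2 ^ m) ^ d) =
      root m i (b i * b (i + d)) * (x * x ^ (2 ^ m) ^ d) by ring, trace_root_mul, mul_pow,
      ← pow_mul x ((2 ^ m) ^ d), ← pow_add _ d i, add_comm d i]
    congr 1
    ring
  simp only [evalR, coeffRF, Finset.sum_mul, Finset.mul_sum, map_sum, ← hterm]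
  rw [Finset.sum_sigma', Finset.sum_sigma']
  refine Finset.sum_nbij' (fun p => ⟨p.1 - p.2, p.2⟩) (fun p => ⟨p.2 + p.1, p.2⟩) ?_ ?_ ?_ ?_ ?_
  · rintro ⟨j, i⟩ h
    simp only [Finset.mem_sigma, Finset.mem_range, Finset.mem_Icc] at h ⊢
    omega
  · rintro ⟨d, i⟩ h
    simp only [Finset.mem_sigma, Finset.mem_range, Finset.mem_Icc] at h ⊢
    omega
  · rintro ⟨j, i⟩ h
    simp only [Finset.mem_sigma, Finset.mem_range] at h
    simp only [Sigma.mk.injEq, heq_eq_eq, and_true]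
    omega
  · rintro ⟨d, i⟩ h
    simp
  · rintro ⟨j, i⟩ h
    simp only [Finset.mem_sigma, Finset.mem_range] at h
    simp only [Nat.add_sub_cancel' h.2.le]

variable {Ω : Type*} [Field Ω] {I : Ω} (hI : IsPrimitiveRoot I 4)

theorem Qq_sum (f : ℕ → K) (n : ℕ) :
    Qq hI (∑ j ∈ Finset.range n, f j) = (∏ j ∈ Finset.range n, Qq hI (f j)) *
      eps K (∑ j ∈ Finset.range n, ∑ i ∈ Finset.range j, f i * f j) := by
  induction n with
  | zero => simp [Qq_zero]
  | succ n ih =>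
    rw [Finset.sum_range_succ, Qq_add, ih, Finset.prod_range_succ, Finset.sum_range_succ,
      AddChar.map_add_eq_mul, Finset.sum_mul]
    push_cast
    ring

/-- Expand $Q$ on $\sum b_ix^{p^i}$ and on $\sum b_i^{p^{-i}}x=F^*(1)x=0$. Corresponding summands
are Frobenius conjugate, so the products of their $Q$-values agree. The cross terms give $R_F$ in
the first expansion and $\gamma_F$ in the second. -/
theorem Qq_linF {m e : ℕ} {b : ℕ → K} (hadj : adjF m e b 1 = 0) (x : K) :
    Qq hI (linF m e b x) =
      eps K (x * (evalR m e (coeffRF m e b) x + gammaF m e b * x)) := by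
  have h1 : ∀ i, Qq hI (b i * x ^ (2 ^ m) ^ i) = Qq hI (root m i (b i) * x) := by
    intro i
    rw [← Qq_pow_two_pow hI (m * i) (root m i (b i) * x), pow_mul, mul_pow, root_pow]
  have h2 := Qq_sum hI (fun i => root m i (b i) * x) (e + 1)
  have h3 : ∑ j ∈ Finset.range (e + 1), ∑ i ∈ Finset.range j,
      root m i (b i) * x * (root m j (b j) * x) = gammaF m e b * (x * x) := by
    rw [gammaF, Finset.sum_mul]
    refine Finset.sum_congr rfl fun j _ => ?_
    rw [Finset.sum_mul]
    refine Finset.sum_congr rfl fun i _ => ?_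
    ring
  rw [← adjF_one_mul, hadj, zero_mul, Qq_zero, h3] at h2
  have h4 : eps K (∑ j ∈ Finset.range (e + 1), ∑ i ∈ Finset.range j,
      b i * x ^ (2 ^ m) ^ i * (b j * x ^ (2 ^ m) ^ j)) =
      eps K (x * evalR m e (coeffRF m e b) x) := by
    rw [eps_apply, eps_apply, trace_sum_lt]
  have h5 := congrArg (Int.cast : ℤ → Ω) (eps_mul_self (gammaF m e b * (x * x)))
  rw [linF, Qq_sum hI _ (e + 1), h4, Finset.prod_congr rfl fun i _ => h1 i, mul_add,
    AddChar.map_add_eq_mul, mul_left_comm x]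
  push_cast at h5 ⊢
  linear_combination (eps K (x * evalR m e (coeffRF m e b) x) : Ω) *
    (-(∏ i ∈ Finset.range (e + 1), Qq hI (root m i (b i) * x)) * h5 -
      (eps K (gammaF m e b * (x * x)) : Ω) * h2)

end Forms

/-! ### Point counts as character sums. -/

section Curves

variable {K : Type*} [Field K] [Algebra (ZMod 2) K] [Fintype K]

/-- The character sum `∑_x (-1)^{Tr(x (R(x) + a x))}`. -/
def formSum (m e : ℕ) (c : ℕ → K) (a : K) : ℤ :=
  ∑ x, eps K (x * (evalR m e c x + a * x))

/-- Such a $v$ is a square $\mu^2$ with $\mu\in\mathbb F_p$, and replacing $x$ by $\mu x$ multiplies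
the form by $v$. -/
theorem sum_eps_mul_fixed {m e : ℕ} (hm : 0 < m) (c : ℕ → K) (a : K) {v : K} (hv0 : v ≠ 0)
    (hv : v ^ 2 ^ m = v) :
    ∑ x, eps K (x * (evalR m e c x + a * x) * v) = formSum m e c a := by
  set μ := v ^ 2 ^ (m - 1) with hμdef
  have hμ2 : μ ^ 2 = v := by
    rw [hμdef, ← pow_mul, ← pow_succ, Nat.sub_add_cancel hm, hv]
  have hμ : μ ^ 2 ^ m = μ := by rw [hμdef, ← pow_mul, mul_comm, pow_mul, hv]
  have hμ0 : μ ≠ 0 := pow_ne_zero _ hv0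
  refine Fintype.sum_equiv (Equiv.mulLeft₀ μ hμ0) _ _ fun x => ?_
  rw [Equiv.mulLeft₀_apply, evalR_mul m e c hμ, ← hμ2]
  congr 1
  ring

variable [CharP K 2]

theorem card_curve_fiber (m : ℕ) [Fintype (artinSchreierAdj K m).ker] [DecidableEq K] (c : K) :
    ((Finset.univ.filter fun y : K => y ^ 2 ^ m - y = c).card : ℤ) =
      ∑ v : (artinSchreierAdj K m).ker, eps K (c * v) := by
  classical
  have hset : (Finset.univ.filter fun y : K => y ^ 2 ^ m - y = c) =
      Finset.univ.filter fun y : K => artinSchreier K m y = c := by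
    ext y
    rw [Finset.mem_filter, Finset.mem_filter, artinSchreier_apply, CharTwo.sub_eq_add]
  rw [(traceAdjoint_artinSchreier m).sum_ker_eps, ker_artinSchreierAdj, hset]
  split_ifs with hc
  · rw [card_fiber_of_mem_range _ hc]
  · rw [Finset.filter_false_of_mem fun y _ hy => hc ⟨y, hy⟩]
    simp

/-- The number of $y$ over each $x$ is a character sum over $v\in\mathbb F_p$; after summing over
$x$, $v=0$ contributes $q$ and each other $v$ the same form sum. -/
theorem ncard_curvePoints {m : ℕ} (hm : 0 < m) (hdvd : m ∣ Module.finrank (ZMod 2) K) (e : ℕ)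
    (c : ℕ → K) (a : K) :
    ((curvePoints m e c a).ncard : ℤ) = Nat.card K + (2 ^ m - 1) * formSum m e c a := by
  classical
  have : Fintype (artinSchreierAdj K m).ker := Fintype.ofFinite _
  have hcard : Fintype.card (artinSchreierAdj K m).ker = 2 ^ m := by
    rw [← Nat.card_eq_fintype_card, ker_artinSchreierAdj, card_ker_artinSchreier hm hdvd]
  have hset : curvePoints m e c a = ↑(Finset.univ.filter fun P : K × K =>
      P.2 ^ 2 ^ m - P.2 = P.1 * (evalR m e c P.1 + a * P.1)) := by
    ext P
    simp [curvePoints]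
  have hcount : ((curvePoints m e c a).ncard : ℤ) =
      ∑ x : K, ∑ v : (artinSchreierAdj K m).ker,
        eps K (x * (evalR m e c x + a * x) * v) := by
    rw [hset, Set.ncard_coe_finset, Finset.card_filter, Fintype.sum_prod_type, Nat.cast_sum]
    refine Finset.sum_congr rfl fun x _ => ?_
    rw [← card_curve_fiber, Finset.card_filter]
  have hv : ∀ v : (artinSchreierAdj K m).ker,
      ∑ x, eps K (x * (evalR m e c x + a * x) * v) =
        formSum m e c a + if v = 0 then (Nat.card K : ℤ) - formSum m e c a else 0 := by
    intro v
    split_ifs with h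
    · rw [h]
      simp
    · rw [sum_eps_mul_fixed hm c a (fun h0 => h (Subtype.ext h0))
        (artinSchreierAdj_eq_zero.1 v.2), add_zero]
  rw [hcount, Finset.sum_comm,
    Finset.sum_congr rfl fun v _ => hv v, Finset.sum_add_distrib, Finset.sum_const,
    Finset.card_univ, hcard, Finset.sum_ite_eq' Finset.univ (0 : (artinSchreierAdj K m).ker)]
  simp
  ring

theorem mem_Tmax_Tmin_iff {m M : ℕ} (hm : 0 < m) (hdvd : m ∣ Module.finrank (ZMod 2) K)
    (hM : Module.finrank (ZMod 2) K = 2 * M) (e : ℕ) (c : ℕ → K) (a : K) :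
    (a ∈ Tmax m e c ↔ formSum m e c a = (2 ^ m) ^ e * 2 ^ M) ∧
      (a ∈ Tmin m e c ↔ formSum m e c a = -((2 ^ m) ^ e * 2 ^ M)) := by
  have hsqrt : √(Nat.card K : ℝ) = 2 ^ M := by
    rw [card_eq_two_pow_finrank, hM, mul_comm 2 M, pow_mul]
    push_cast
    exact Real.sqrt_sq (by positivity)
  have hcount : ((curvePoints m e c a).ncard : ℝ) =
      Nat.card K + (2 ^ m - 1) * (formSum m e c a : ℝ) := by
    exact_mod_cast congrArg (Int.cast : ℤ → ℝ) (ncard_curvePoints hm hdvd e c a)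
  have hp : (2 : ℝ) ^ m - 1 ≠ 0 := by
    have := one_lt_pow₀ (one_lt_two (α := ℝ)) hm.ne'
    exact (sub_pos.2 this).ne'
  constructor
  · rw [Tmax, Set.mem_ofPred_eq, hcount, hsqrt, mul_assoc, add_right_inj, mul_right_inj' hp]
    exact_mod_cast Iff.rfl
  · rw [Tmin, Set.mem_ofPred_eq, hcount, hsqrt, mul_assoc, sub_eq_add_neg _ (_ * _), add_right_inj,
      ← mul_neg, mul_right_inj' hp]
    exact_mod_cast Iff.rfl

end Curves

/-! ### Translates $t+F(u)$ and the radical of the form. -/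

section Translates

variable {K : Type*} [Field K] [CharP K 2] [Algebra (ZMod 2) K]
  {Ω : Type*} [Field Ω] {I : Ω} (hI : IsPrimitiveRoot I 4)
  {m e : ℕ} {b : ℕ → K}

theorem alphaF_add_linF {K : Type*} [Field K] [CharP K 2] [PerfectRing K 2] (m e : ℕ) (b : ℕ → K) (t u : K) :
    alphaF m e b (t + linF m e b u) = alphaF m e b t + EF m e b u ^ 2 := by
  have h : adjF m e b (t + linF m e b u) = adjF m e b t + EF m e b u :=
    map_add (adjFHom m e b) _ _
  rw [alphaF, alphaF, h, CharTwo.add_sq, add_assoc]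

/-- The cross term is $\psi(tF(u))=\psi(F^*(t)u)=\psi(F^*(t)^2u^2)$, which is why $F^*(t)^2$ enters
$\alpha_F(t)$. -/
theorem Qq_add_linF [Finite K] (hadj : adjF m e b 1 = 0) (t u : K) :
    Qq hI (t + linF m e b u) = Qq hI t * eps K (u * RFt m e b t u) := by
  have h1 : eps K (t * linF m e b u) = eps K ((adjF m e b t * u) ^ 2) := by
    rw [eps_sq, mul_comm, mul_comm (adjF m e b t)]
    exact (traceAdjoint_linF m e b).eps_eq u t
  rw [Qq_add, Qq_linF hI hadj, h1, mul_assoc, ← Int.cast_mul, ← AddChar.map_add_eq_mul, RFt,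
    alphaF]
  congr 3
  ring

theorem formSum_alphaF_mul_Qq [Fintype K] [CharZero Ω] (hadj : adjF m e b 1 = 0) {t : K}
    (ht : ∀ v, adjF m e b v = 0 → Qq hI v = eps K (t * v)) :
    (formSum m e (coeffRF m e b) (alphaF m e b t) : Ω) * Qq hI t =
      Nat.card (linFHom m e b).ker * ∑ s : K, Qq hI s := by
  rw [← sum_Qq_add_range hI (traceAdjoint_linF m e b) ht, formSum, Int.cast_sum, Finset.sum_mul]
  refine Finset.sum_congr rfl fun x _ => ?_
  rw [mul_comm]
  exact (Qq_add_linF hI hadj t x).symm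

/-- The form is $Q\circ F$ times an additive character of $x^2$, and $F(v)\in\ker F^*$ is orthogonal
to the range of $F$, so the mixed term disappears. -/
theorem eps_form_add [Finite K] [CharZero Ω] (hI : IsPrimitiveRoot I 4)
    (hadj : adjF m e b 1 = 0) (a : K) {v : K} (hv : EF m e b v = 0) (x : K) :
    eps K ((x + v) * (evalR m e (coeffRF m e b) (x + v) + a * (x + v))) =
      eps K (x * (evalR m e (coeffRF m e b) x + a * x)) *
        eps K (v * (evalR m e (coeffRF m e b) v + a * v)) := by
  have hx : ∀ x : K, (eps K (x * (evalR m e (coeffRF m e b) x + a * x)) : Ω) =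
      Qq hI (linF m e b x) * eps K ((a - gammaF m e b) * x ^ 2) := by
    intro x
    rw [Qq_linF hI hadj, ← Int.cast_mul, ← AddChar.map_add_eq_mul]
    congr 2
    ring
  have hF : linF m e b (x + v) = linF m e b x + linF m e b v := map_add (linFHom m e b) x v
  have h0 : eps K (linF m e b x * linF m e b v) = 1 := by
    have h := (traceAdjoint_linF m e b).eps_eq x (linF m e b v)
    rw [show adjFHom m e b (linF m e b v) = 0 from hv, mul_zero, AddChar.map_zero_eq_one] at h
    exact h
  apply Int.cast_injective (α := Ω)
  rw [Int.cast_mul, hx, hx, hx, hF, Qq_add, h0, CharTwo.add_sq, mul_add, AddChar.map_add_eq_mul]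
  push_cast
  ring

/-- Translation by $v$ multiplies the form sum by this sign, so a nonzero sum forces the sign to be
1. -/
theorem eps_form_eq_one [Fintype K] [CharZero Ω] (hI : IsPrimitiveRoot I 4)
    (hadj : adjF m e b 1 = 0) {a : K} (ha : formSum m e (coeffRF m e b) a ≠ 0) {v : K}
    (hv : EF m e b v = 0) :
    eps K (v * (evalR m e (coeffRF m e b) v + a * v)) = 1 := by
  apply mul_left_cancel₀ ha
  rw [mul_one, formSum, Finset.sum_mul]
  refine Fintype.sum_equiv (Equiv.addRight v) _ _ fun x => ?_
  exact (eps_form_add hI hadj a hv x).symm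

theorem exists_eq_add_EF_sq [Fintype K] [CharZero Ω] (hI : IsPrimitiveRoot I 4)
    (hadj : adjF m e b 1 = 0) {a a' : K} (ha : formSum m e (coeffRF m e b) a ≠ 0)
    (ha' : formSum m e (coeffRF m e b) a' ≠ 0) : ∃ u, a' = a + EF m e b u ^ 2 := by
  -- With $m=i=1$, `root` is the ordinary square root.
  have hw : root 1 1 (a + a') ^ 2 = a + a' := root_pow 1 1 (a + a')
  obtain ⟨u, hu⟩ := ((traceAdjoint_EF m e b).mem_range_iff (root 1 1 (a + a'))).2 fun v hv => by
    have h1 := eps_form_eq_one hI hadj ha hv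
    have h2 := eps_form_eq_one hI hadj ha' hv
    rw [← eps_sq, mul_pow, hw, ← mul_one (1 : ℤ)]
    nth_rw 2 [← h1]
    rw [← h2, ← AddChar.map_add_eq_mul]
    congr 1
    linear_combination -(v * evalR m e (coeffRF m e b) v) * CharTwo.two_eq_zero (R := K)
  refine ⟨u, ?_⟩
  rw [show EF m e b u = root 1 1 (a + a') from hu, hw, ← add_assoc, CharTwo.add_self_eq_zero,
    zero_add]

end Translates

section Kernels

variable {K : Type*} [Field K] [Finite K] [CharP K 2] {m e : ℕ} {b : ℕ → K}

theorem algebraMap_mem_WFstar (v : K) :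
    algebraMap K (AlgebraicClosure K) v ∈ WFstar m e b ↔ adjF m e b v = 0 := by
  rw [WFstar, Set.mem_ofPred_eq, adjF_algebraMap, map_eq_zero]

/-- Rationality of the roots of $F$ follows from $\ker F\subset V_F\subset\mathbb F_q$. -/
theorem Admissible.card_ker_linFHom (hF : Admissible m e b) (hm : 0 < m) :
    Nat.card (linFHom m e b).ker = (2 ^ m) ^ e := by
  have hb := mul_ne_zero_iff.1 hF.coeff_ne_zero
  refine GeerVlugt.card_ker_linFHom hm hb.1 hb.2 fun x hx => hF.VF_subset ?_
  rw [VF, Set.mem_ofPred_eq, EF, hx]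
  exact map_zero (adjFHom m e _)

end Kernels

/-! ### The coset $S_F$ and the sign of the form sum. -/

section Main

variable {K : Type*} [Field K] [Finite K] [CharP K 2] [Algebra (ZMod 2) K]
  {Ω : Type*} [Field Ω] {I : Ω} (hI : IsPrimitiveRoot I 4) {m e : ℕ} {b : ℕ → K}

theorem mem_SF_iff {t : K} :
    t ∈ SF hI m e b ↔ ∀ v, adjF m e b v = 0 → Qq hI v = eps K (t * v) := by
  simp only [SF, Set.mem_ofPred_eq, algebraMap_mem_WFstar, psiq_eq_eps]

/-- A difference of two elements of $S_F$ is orthogonal to $\ker F^*$, hence a value of $F$, and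
conversely. -/
theorem SF_eq_coset [CharZero Ω] {t₀ : K} (ht₀ : t₀ ∈ SF hI m e b) :
    SF hI m e b = {t | ∃ u : K, t = t₀ + linF m e b u} := by
  ext t
  have h0 := (mem_SF_iff hI).1 ht₀
  have hiff : t ∈ SF hI m e b ↔ t - t₀ ∈ (linFHom m e b).range := by
    rw [mem_SF_iff, (traceAdjoint_linF m e b).mem_range_iff]
    refine forall₂_congr fun v hv => ?_
    rw [h0 v hv, Int.cast_inj, sub_mul, CharTwo.sub_eq_add, AddChar.map_add_eq_mul]
    have h1 := eps_mul_self (t₀ * v)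
    constructor
    · intro h
      rw [← h, h1]
    · intro h
      linear_combination (eps K (t * v)) * h1 - (eps K (t₀ * v)) * h
  rw [hiff]
  constructor
  · rintro ⟨u, hu⟩
    exact ⟨u, by rw [show linF m e b u = t - t₀ from hu, add_sub_cancel]⟩
  · rintro ⟨u, rfl⟩
    exact ⟨u, by rw [add_sub_cancel_left]; rfl⟩

theorem formSum_alphaF_add_EF_sq [Fintype K] [CharZero Ω] (hm : 0 < m) (hF : Admissible m e b)
    {M n : ℕ} (hN : Module.finrank (ZMod 2) K = 2 * n * M) {t₀ : K} (ht₀ : t₀ ^ 2 ^ M + t₀ = 1)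
    (hS : t₀ ∈ SF hI m e b) (u : K) :
    formSum m e (coeffRF m e b) (alphaF m e b t₀ + EF m e b u ^ 2) =
      (2 ^ m) ^ e * 2 ^ (n * M) * ((-1) ^ (n + 1) * eps K (u * RFt m e b t₀ u)) := by
  have hI0 : I ≠ 0 := hI.ne_zero (by norm_num)
  have hu : t₀ + linF m e b u ∈ SF hI m e b := by
    rw [SF_eq_coset hI hS]
    exact ⟨u, rfl⟩
  have h := formSum_alphaF_mul_Qq hI hF.adj_one ((mem_SF_iff hI).1 hu)
  rw [alphaF_add_linF, Qq_add_linF hI hF.adj_one, Qq_of_pow_add_eq_one hI hN ht₀,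
    hF.card_ker_linFHom hm, sum_Qq hI (M := n * M) (by rw [hN, mul_assoc])] at h
  have h1 : ((-1 : ℤ) ^ n) * (-1) ^ n = 1 := by rw [← mul_pow]; simp
  have h1' := congrArg (Int.cast : ℤ → Ω) h1
  have h2 := congrArg (Int.cast : ℤ → Ω) (eps_mul_self (u * RFt m e b t₀ u))
  apply Int.cast_injective (α := Ω)
  apply mul_right_cancel₀ (pow_ne_zero (n * M) hI0)
  push_cast at h h1' h2 ⊢
  rw [pow_succ (-1 : Ω) n]
  generalize (formSum m e (coeffRF m e b) (alphaF m e b t₀ + EF m e b u ^ 2) : Ω) = S at *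
  generalize (eps K (u * RFt m e b t₀ u) : Ω) = ε at *
  linear_combination (-1) ^ n * ε * h - S * I ^ (n * M) * ε * ε * h1' - S * I ^ (n * M) * h2

end Main

end GeerVlugt

theorem theorem6p6
    -- `K = 𝔽_q` with `p = 2 ^ m`, `q₁ = p ^ k`, `q = q₁ ^ (2 n)`
    {K : Type*} [Field K] [Finite K] [CharP K 2] [Algebra (ZMod 2) K]
    (m k n q₁ : ℕ) (hm : 0 < m) (hk : 0 < k) (hn : 0 < n)
    (hq₁ : q₁ = (2 ^ m) ^ k) (hq : Nat.card K = q₁ ^ (2 * n))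
    -- a primitive fourth root of unity in an algebraic closure of `ℚ_ℓ`
    (ℓ : ℕ) [Fact ℓ.Prime] (hℓ : ℓ ≠ 2)
    (I : AlgebraicClosure ℚ_[ℓ]) (hI : IsPrimitiveRoot I 4)
    -- `F = ∑_{i=0}^e b_i x^{p^i}`
    (e : ℕ) (b : ℕ → K) (hF : GeerVlugt.Admissible m e b)
    (hW : GeerVlugt.WFstar m e b ⊆ {x | x ^ q₁ = x}) :
    (∃ t₀ : K, t₀ ^ q₁ ^ 2 = t₀ ∧ t₀ ^ q₁ + t₀ = 1) ∧
    ∀ t₀ : K, t₀ ^ q₁ ^ 2 = t₀ → t₀ ^ q₁ + t₀ = 1 →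
      GeerVlugt.SF hI m e b = {t | ∃ u : K, t = t₀ + GeerVlugt.linF m e b u} ∧
      GeerVlugt.Tmax m e (GeerVlugt.coeffRF m e b) ∪
          GeerVlugt.Tmin m e (GeerVlugt.coeffRF m e b) =
        {a | ∃ u : K, a = GeerVlugt.alphaF m e b t₀ + GeerVlugt.EF m e b u ^ 2} ∧
      GeerVlugt.SFminus hI m e b =
        {t | ∃ u : K,
          Algebra.trace (ZMod 2) K (u * GeerVlugt.RFt m e b t₀ u) = (n : ZMod 2) + 1 ∧
          t = t₀ + GeerVlugt.linF m e b u} ∧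
      GeerVlugt.Tmax m e (GeerVlugt.coeffRF m e b) =
        {a | ∃ u : K,
          Algebra.trace (ZMod 2) K (u * GeerVlugt.RFt m e b t₀ u) = (n : ZMod 2) + 1 ∧
          a = GeerVlugt.alphaF m e b t₀ + GeerVlugt.EF m e b u ^ 2} := by
  open GeerVlugt in
  have : Fintype K := Fintype.ofFinite K
  have hI0 : I ≠ 0 := hI.ne_zero (by norm_num)
  have hq₁' : q₁ = 2 ^ (m * k) := by rw [hq₁, pow_mul]
  have hN : Module.finrank (ZMod 2) K = 2 * n * (m * k) := by
    rw [card_eq_two_pow_finrank, hq₁', ← pow_mul] at hq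
    rw [Nat.pow_right_injective le_rfl hq, mul_comm]
  have hdvd : m ∣ Module.finrank (ZMod 2) K := ⟨2 * n * k, by rw [hN]; ring⟩
  have hM : Module.finrank (ZMod 2) K = 2 * (n * (m * k)) := by rw [hN, mul_assoc]
  refine ⟨?_, fun t₀ _ ht₀ => ?_⟩
  · obtain ⟨t, ht⟩ := exists_pow_add_eq_one hN
    rw [← hq₁'] at ht
    have ht' : t ^ q₁ = t + 1 := by
      rw [← ht, add_comm, add_assoc, CharTwo.add_self_eq_zero, add_zero]
    refine ⟨t, ?_, ht⟩
    rw [sq, pow_mul, ht', hq₁', add_pow_char_pow, ← hq₁', ht', one_pow, add_assoc,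
      CharTwo.add_self_eq_zero, add_zero]
  rw [hq₁'] at ht₀
  have hS : t₀ ∈ SF hI m e b := by
    refine (mem_SF_iff hI).2 fun v hv => Qq_eq_eps_of_fixed hI hN ht₀ ?_
    have h := hW ((algebraMap_mem_WFstar v).2 hv)
    rw [Set.mem_ofPred_eq, ← map_pow, hq₁'] at h
    exact (algebraMap K (AlgebraicClosure K)).injective h
  have hsum := formSum_alphaF_add_EF_sq hI hm hF hN ht₀ hS
  have hT := mem_Tmax_Tmin_iff (K := K) hm hdvd hM e (coeffRF m e b)
  have hpos : ((2 : ℤ) ^ m) ^ e * 2 ^ (n * (m * k)) ≠ 0 := by positivity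
  have htrace : ∀ x : K, Algebra.trace (ZMod 2) K x = (n : ZMod 2) + 1 ↔
      eps K x = (-1) ^ (n + 1) := by
    intro x
    rw [eps_eq_neg_one_pow_iff, Nat.cast_add, Nat.cast_one]
  have hsign : ∀ x : K, (-1) ^ (n + 1) * eps K x = 1 ∨ (-1) ^ (n + 1) * eps K x = -1 := by
    intro x
    rw [eps_apply, ← pow_add]
    exact neg_one_pow_eq_or ℤ _
  have hone : ∀ x : K, (-1) ^ (n + 1) * eps K x = 1 ↔ eps K x = (-1) ^ (n + 1) := by
    intro x
    have h : ((-1 : ℤ) ^ (n + 1)) * (-1) ^ (n + 1) = 1 := by rw [← mul_pow]; simp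
    constructor
    · intro h'
      linear_combination (-1) ^ (n + 1) * h' - eps K x * h
    · intro h'
      rw [h', h]
  have hunion : Tmax m e (coeffRF m e b) ∪ Tmin m e (coeffRF m e b) =
      {a | ∃ u : K, a = alphaF m e b t₀ + EF m e b u ^ 2} := by
    ext a
    rw [Set.mem_union, (hT a).1, (hT a).2]
    constructor
    · intro ha
      have h0 : formSum m e (coeffRF m e b) a ≠ 0 := by
        rcases ha with ha | ha <;> rw [ha]
        · exact hpos
        · exact neg_ne_zero.2 hpos
      -- Taking $u=0$ gives the base point $\alpha_F(t_0)$, to which any other $a$ with nonzero form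
      -- sum is compared.
      have h1 : formSum m e (coeffRF m e b) (alphaF m e b t₀ + EF m e b 0 ^ 2) ≠ 0 := by
        rw [hsum]
        refine mul_ne_zero hpos ?_
        rcases hsign (0 * RFt m e b t₀ 0) with h | h <;> rw [h] <;> norm_num
      rw [show EF m e b 0 = 0 from map_zero (EFHom m e b), zero_pow two_ne_zero, add_zero] at h1
      exact exists_eq_add_EF_sq hI hF.adj_one h1 h0
    · rintro ⟨u, rfl⟩
      rw [hsum]
      rcases hsign (u * RFt m e b t₀ u) with h | h <;> rw [h]
      · exact Or.inl (mul_one _)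
      · exact Or.inr (mul_neg_one _)
  refine ⟨SF_eq_coset hI hS, hunion, ?_, ?_⟩
  · have hQ : ∀ u : K, Qq hI (t₀ + linF m e b u) = -I ^ (Module.finrank (ZMod 2) K / 2) ↔
        Algebra.trace (ZMod 2) K (u * RFt m e b t₀ u) = (n : ZMod 2) + 1 := by
      intro u
      rw [Qq_add_linF hI hF.adj_one, Qq_of_pow_add_eq_one hI hN ht₀, hM,
        Nat.mul_div_cancel_left _ two_pos, htrace, ← hone]
      constructor
      · intro h
        apply Int.cast_injective (α := AlgebraicClosure ℚ_[ℓ])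
        apply mul_left_cancel₀ (pow_ne_zero (n * (m * k)) hI0)
        push_cast
        rw [pow_succ (-1 : AlgebraicClosure ℚ_[ℓ]) n]
        linear_combination -h
      · intro h
        have h' := congrArg (Int.cast : ℤ → AlgebraicClosure ℚ_[ℓ]) h
        push_cast at h'
        rw [pow_succ (-1 : AlgebraicClosure ℚ_[ℓ]) n] at h'
        linear_combination -I ^ (n * (m * k)) * h'
    ext t
    rw [SFminus, Set.mem_ofPred_eq, SF_eq_coset hI hS]
    constructor
    · rintro ⟨⟨u, rfl⟩, h⟩
      exact ⟨u, (hQ u).1 h, rfl⟩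
    · rintro ⟨u, h, rfl⟩
      exact ⟨⟨u, rfl⟩, (hQ u).2 h⟩
  · ext a
    constructor
    · intro ha
      have hmem : a ∈ {a | ∃ u : K, a = alphaF m e b t₀ + EF m e b u ^ 2} := by
        rw [← hunion]
        exact Or.inl ha
      obtain ⟨u, rfl⟩ := hmem
      refine ⟨u, ?_, rfl⟩
      rw [htrace, ← hone]
      rw [(hT _).1, hsum] at ha
      exact mul_left_cancel₀ hpos (ha.trans (mul_one _).symm)
    · rintro ⟨u, h, rfl⟩
      rw [htrace, ← hone] at h
      rw [(hT _).1, hsum, h, mul_one]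

end
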